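/- For a meromorphic function $g$ on $\mathbb{C}$ let $m(r,g)$ and $T(r,g)$ denote the Nevanlinna proximity function and characteristic. A measurable set $E\subset(0,\infty)$ has finite logarithmic measure if $\int_E \frac{dr}{r}<\infty$. Let $f$ be a non-constant meromorphic function on $\mathbb{C}$ of finite order, i.e. $\limsup_{r\to\infty}\frac{\log^+T(r,f)}{\log r}<\infty$. Call a meromorphic function $b$ on $\mathbb{C}$ small with respect to $f$ if $T(r,b)=o(T(r,f))$ as $r\to\infty$ outside a set of finite logarithmic measure. Let $c_1,\dots,c_n\in\mathbb{C}$, $|c|:=\max_j|c_j|$, and let $$P(z,f)=\sum_{\lambda} a_\lambda(z)\prod_{j=1}^n f(z+c_j)^{\lambda_j}$$ be a difference polynomial in $f$, that is, a finite sum over multi-indices $\lambda=(\lambda_1,\dots,\lambda_n)$ of non-negative integers, whose coefficients $a_\lambda$ are meromorphic functions small with respect to $f$. Suppose that $P(z,f)= 0$, and let $a$ be a slowly moving target, i.e. a meromorphic function small with respect to $f$, such that $P(z,a)\not\equiv0$. Then for every real $\delta<1$ there is a set $E$ of finite logarithmic measure such that $$m\left(r,\frac{1}{f-a}\right)=o\left(\frac{T(r+|c|,f)}{r^{\delta}}\right)+o\big(T(r,f)\big)\qquad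 (r\to\infty,\ r\notin E).$$ Moreover, the Nevanlinna deficiency satisfies $$\delta(a,f):=\liminf_{r\to\infty}\frac{m\left(r,\frac{1}{f-a}\right)}{T(r,f)}=0.$$ -/

import Mathlib

open Filter Topology MeasureTheory Asymptotics ValueDistribution

noncomputable section

namespace DifferenceNevanlinna

/-- Finite logarithmic measure: `∫_E dr / r < ∞` for a measurable set `E` of positive reals. -/
def FiniteLogMeasure (E : Set ℝ) : Prop :=
  MeasurableSet E ∧ E ⊆ Set.Ioi 0 ∧ ∫⁻ r in E, ENNReal.ofReal (1 / r) < ⊤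

/-- The filter `r → ∞`, `r ∉ E`. -/
def atTopOff (E : Set ℝ) : Filter ℝ := atTop ⊓ 𝓟 Eᶜ

/-- Nevanlinna characteristic `T(r, f) = m(r, f) + N(r, f)`. -/
def T (f : ℂ → ℂ) (r : ℝ) : ℝ := characteristic f ⊤ r

/-- Nevanlinna proximity function `m(r, f)`. -/
def m (f : ℂ → ℂ) (r : ℝ) : ℝ := proximity f ⊤ r

/-- Equality as meromorphic functions: values on a discrete closed set (in particular the values
that Lean assigns at poles) are disregarded. -/
def MerEq (f g : ℂ → ℂ) : Prop := f =ᶠ[codiscrete ℂ] g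

/-- The order of growth `limsup log⁺ T(r, f) / log r`. -/
def order (f : ℂ → ℂ) : EReal :=
  limsup (fun r : ℝ ↦ ((Real.posLog (T f r) / Real.log r : ℝ) : EReal)) atTop

/-- `a` is a meromorphic function, small compared to `f`: `T(r, a) = o(T(r, f))` as `r → ∞`
outside a set of finite logarithmic measure. -/
def IsSmall (f a : ℂ → ℂ) : Prop :=
  Meromorphic a ∧ ∃ E : Set ℝ, FiniteLogMeasure E ∧ T a =o[atTopOff E] T f

/-- A polynomial in the variables `f(z + c₁), …, f(z + cₙ)` whose coefficients are functions
of `z` is a difference polynomial in `f` if all coefficients are small compared to `f`. -/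
def IsDifferencePolynomial {n : ℕ} (f : ℂ → ℂ) (P : MvPolynomial (Fin n) (ℂ → ℂ)) : Prop :=
  ∀ l : Fin n →₀ ℕ, IsSmall f (P.coeff l)

/-- The function `z ↦ P(z, g)`, for the shifts `c`. -/
def evalAt {n : ℕ} (c : Fin n → ℂ) (P : MvPolynomial (Fin n) (ℂ → ℂ)) (g : ℂ → ℂ) : ℂ → ℂ :=
  MvPolynomial.eval (fun j z ↦ g (z + c j)) P

theorem evalAt_apply {n : ℕ} (c : Fin n → ℂ) (P : MvPolynomial (Fin n) (ℂ → ℂ)) (g : ℂ → ℂ)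
    (z : ℂ) :
    evalAt c P g z = ∑ l ∈ P.support, P.coeff l z * ∏ j, g (z + c j) ^ l j := by
  simp [evalAt, MvPolynomial.eval_eq', Finset.sum_apply, Finset.prod_apply]

/-- `|c| = max |c_j|` (and `0` if there are no shifts). -/
def maxShift {n : ℕ} (c : Fin n → ℂ) : ℝ := ⨆ j, ‖c j‖

/-- Nevanlinna deficiency of the target `a`:
`liminf m(r, 1 / (f - a)) / T(r, f)` as `r → ∞`. -/
def deficiency (a f : ℂ → ℂ) : EReal :=
  liminf (fun r : ℝ ↦ ((m (fun z ↦ 1 / (f z - a z)) r / T f r : ℝ) : EReal)) atTop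

end DifferenceNevanlinna

end

/-!
A solution `f` of `P (z, f) = 0` cannot be close to `a` on a large part of a circle when
`P (z, a) ≢ 0`. Put `g = f - a` and expand `P (z, f) = P (z, a + g)` about `a`: every term of
`P (z, a + g) - P (z, a)` contains a factor `g (z + c_j)`, so that at the points where `|g| ≤ 1` the
quantity `1 / |g|` is bounded by `1 / |P (z, a)|` times a polynomial in the coefficients, the shifts
`a (z + c_j)` and the difference quotients `g (z + c_j) / g z` (`posLog_inv_sub_le`). Hence
`m (r, 1 / g)` is at most a sum of `T (r, P (z, a))` and of proximity functions of these functions,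
and each of them has to be shown to be `o (T (r, f))`.

The main tool is the difference analogue of the lemma on the logarithmic derivative,
`proximity_shift_div_isLittleO`: with `R = r + r ^ (3/4)`,
`m (r, g (z + c) / g z) = o (T (R, g) + 1)` for every meromorphic `g ≢ 0`. To prove it, `log |g|` is
written on a disk as a harmonic function plus the logarithmic potential of the zeros and poles
(`exists_harmonic_add_potential`). The increments of the harmonic part are controlled by the
Poisson formula (`harmonic_sub_le`). Those of the potential are controlled pole by pole: on the
circle, `log (1 + |c| / |z - b|)` is dominated by a difference of two logarithms whose mean value
is known exactly (`exists_log_one_add_div_le`, `circleAverage_log_displacement`). The same result,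
together with a comparison of counting functions, gives `T (r, a (z + c)) = O (T (R, a) + 1)`
(`T_shift_isBigO`).

The enlarged radius is harmless: since `log⁺ T (r, f) = O (log r)`, one has
`T (R, f) ≤ 2 T (r, f)` off a set of finite logarithmic measure (`exists_T_enlarge_isBigO`, from
the telescoping estimate `log_two_mul_volume_le`), and the substitution `r ↦ R` preserves finiteness
of the logarithmic measure (`FiniteLogMeasure.preimage_enlarge`).

The outcome is `m (r, 1 / (f - a)) = o (T (r, f))` off a set of finite logarithmic measure. In
particular the error term `o (T (r + |c|, f) / r ^ δ)` can be taken to be zero: for functions of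
finite order, `T (r + |c|, f)` is of the same size as `T (r, f)` off such a set. As the complement
of a set of finite logarithmic measure is unbounded, the deficiency vanishes.
-/

namespace DifferenceNevanlinna

open Real Metric Set

/-! ### Circle averages -/

lemma compl_singleton_mem_codiscrete (b : ℂ) : ({b}ᶜ : Set ℂ) ∈ codiscrete ℂ := by
  rw [mem_codiscrete']
  simpa using (Set.finite_singleton b).isDiscrete

lemma tendsto_add_const_codiscrete (c : ℂ) :
    Tendsto (fun z : ℂ ↦ z + c) (codiscrete ℂ) (codiscrete ℂ) := by
  intro s hs
  rw [mem_map, mem_codiscrete]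
  intro x
  rw [mem_codiscrete] at hs
  have h := hs (x + c)
  rw [disjoint_principal_right, compl_compl] at h ⊢
  have ht : Tendsto (fun z : ℂ ↦ z + c) (𝓝[≠] x) (𝓝[≠] (x + c)) :=
    ((continuous_add_const c).continuousAt.continuousWithinAt).tendsto_nhdsWithin
      (fun y hy ↦ by simpa using hy)
  exact ht h

lemma circleAverage_mono_of_codiscrete {u v : ℂ → ℝ} {r : ℝ} (hr : r ≠ 0)
    (hu : CircleIntegrable u 0 r) (hv : CircleIntegrable v 0 r)
    (h : u ≤ᶠ[codiscrete ℂ] v) : circleAverage u 0 r ≤ circleAverage v 0 r := by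
  have hw : (fun z ↦ max (u z) (v z)) =ᶠ[codiscreteWithin (sphere (0 : ℂ) |r|)] v := by
    refine Filter.EventuallyEq.filter_mono ?_ (codiscreteWithin_mono (subset_univ _))
    filter_upwards [h] with z hz using max_eq_right hz
  rw [← circleAverage_congr_codiscreteWithin hw hr]
  exact circleAverage_mono hu (hv.congr_codiscreteWithin hw.symm) fun z _ ↦ le_max_left _ _

lemma circleAverage_const_mul (k : ℝ) (u : ℂ → ℝ) (r : ℝ) :
    circleAverage (fun z ↦ k * u z) 0 r = k * circleAverage u 0 r :=
  circleAverage_fun_smul (a := k) (f := u)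

/-! ### Harmonic functions on a disk -/

/-- The Poisson formula turns the Lipschitz bound for the Herglotz–Riesz kernel into a Lipschitz
bound for harmonic functions on a smaller disk, in terms of the mean of `|H|` over the boundary. -/
lemma harmonic_sub_le {H : ℂ → ℝ} {R d : ℝ} (hd : 0 < d)
    (hH : InnerProductSpace.HarmonicOnNhd H (closedBall 0 R)) {z w : ℂ}
    (hz : ‖z‖ ≤ R - d) (hw : ‖w‖ ≤ R - d) :
    |H z - H w| ≤ 2 * R * ‖z - w‖ / d ^ 2 * circleAverage (fun ζ ↦ |H ζ|) 0 R := by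
  have hR : 0 < R := by linarith [norm_nonneg z]
  have hz' : z ∈ ball (0 : ℂ) R := by simp; linarith
  have hw' : w ∈ ball (0 : ℂ) R := by simp; linarith
  have hHc : ContinuousOn H (sphere 0 R) := fun x hx ↦
    (hH x (sphere_subset_closedBall hx)).1.continuousAt.continuousWithinAt
  have hk : ∀ v ∈ ball (0 : ℂ) R,
      CircleIntegrable ((Complex.re ∘ herglotzRieszKernel 0 v) • H) 0 R := by
    intro v hv
    refine ContinuousOn.circleIntegrable hR.le (ContinuousOn.smul ?_ hHc)
    have := continuousOn_herglotzRieszKernel_sphere hv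
    rw [abs_of_pos hR] at this
    exact Complex.continuous_re.comp_continuousOn this
  rw [← hH.circleAverage_re_herglotzRieszKernel_smul hz',
    ← hH.circleAverage_re_herglotzRieszKernel_smul hw', ← circleAverage_sub (hk z hz') (hk w hw'),
    ← circleAverage_const_mul]
  refine abs_circleAverage_le_circleAverage_abs.trans ?_
  refine circleAverage_mono ((hk z hz').sub (hk w hw')).abs ?_ ?_
  · exact (ContinuousOn.circleIntegrable hR.le (continuousOn_const.mul hHc.abs))
  · intro ζ hζ
    rw [abs_of_pos hR, mem_sphere_zero_iff_norm] at hζ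
    have h1 : d ≤ ‖ζ - z‖ := by
      have := norm_sub_norm_le ζ z; linarith
    have h2 : d ≤ ‖ζ - w‖ := by
      have := norm_sub_norm_le ζ w; linarith
    have h1' : ζ - z ≠ 0 := norm_pos_iff.1 (hd.trans_le h1)
    have h2' : ζ - w ≠ 0 := norm_pos_iff.1 (hd.trans_le h2)
    have e : herglotzRieszKernel 0 z ζ - herglotzRieszKernel 0 w ζ
        = 2 * ζ * (z - w) / ((ζ - z) * (ζ - w)) := by
      simp only [herglotzRieszKernel_def, sub_zero]
      field_simp
      ring
    simp only [Pi.abs_apply, Pi.sub_apply, smul_eq_mul, Pi.mul_apply, Function.comp_apply]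
    rw [← sub_mul, abs_mul, ← Complex.sub_re, e]
    refine mul_le_mul_of_nonneg_right ((Complex.abs_re_le_norm _).trans ?_) (abs_nonneg _)
    rw [norm_div, norm_mul, norm_mul, norm_mul, hζ, Complex.norm_two, sq]
    gcongr

lemma circleAverage_abs_log_sub_le {R : ℝ} (hR : 1 ≤ R) {b : ℂ} (hb : ‖b‖ ≤ R) :
    circleAverage (fun ζ ↦ |log ‖ζ - b‖ - log R|) 0 R ≤ 2 * log 2 := by
  have hi : CircleIntegrable (fun ζ : ℂ ↦ log ‖ζ - b‖ - log R) 0 R :=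
    (circleIntegrable_log_norm_sub_const R).sub (circleIntegrable_const _ _ _)
  -- `|x| ≤ 2 log 2 - x` as soon as `x ≤ log 2`
  have h1 : circleAverage (fun ζ ↦ |log ‖ζ - b‖ - log R|) 0 R ≤
      circleAverage (fun ζ : ℂ ↦ 2 * log 2 - (log ‖ζ - b‖ - log R)) 0 R := by
    refine circleAverage_mono hi.abs ((circleIntegrable_const _ _ _).sub hi) fun ζ hζ ↦ ?_
    rw [abs_of_pos (by linarith), mem_sphere_zero_iff_norm] at hζ
    have h2 : log ‖ζ - b‖ ≤ log 2 + log R := by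
      rw [← log_mul (by norm_num) (by linarith)]
      rcases eq_or_ne (ζ - b) 0 with h0 | h0
      · rw [h0, norm_zero, log_zero]; exact log_nonneg (by linarith)
      · exact log_le_log (norm_pos_iff.2 h0) ((norm_sub_le _ _).trans (by linarith))
    have := log_nonneg (show (1 : ℝ) ≤ 2 by norm_num)
    rw [abs_le]; constructor <;> linarith
  have h3 : circleAverage (fun ζ : ℂ ↦ 2 * log 2 - (log ‖ζ - b‖ - log R)) 0 R = 2 * log 2 := by
    rw [circleAverage_fun_sub (circleIntegrable_const _ _ _) hi, circleAverage_const,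
      circleAverage_fun_sub (circleIntegrable_log_norm_sub_const R) (circleIntegrable_const _ _ _),
      circleAverage_const, circleAverage_log_norm_sub_const_of_mem_closedBall]
    · simp
    · simpa [abs_of_pos (show 0 < R by linarith)] using hb
  exact h1.trans_eq h3

/-! ### Displacement of a logarithmic pole -/

/-- A bound for `log (1 + k / ‖ζ - b‖)` on the circle of radius `r` whose mean value is explicitly
known. The point `b` is first projected radially to `r • e` on the circle, which changes the
distance at most by a factor two; moving it outwards by `√(8kr + 4k²)` then increases
the distance to each point of the circle by the required amount, by Pythagoras. -/
lemma exists_log_one_add_div_le (b : ℂ) {r k : ℝ} (hr : 0 < r) (hk : 0 ≤ k) :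
    ∃ e : ℂ, ‖e‖ = 1 ∧ ∀ ζ : ℂ, ‖ζ‖ = r → ζ ≠ b → ζ ≠ r * e →
      log (1 + k / ‖ζ - b‖) ≤
        log ‖ζ - (r + √(8 * k * r + 4 * k ^ 2) : ℝ) * e‖ - log ‖ζ - r * e‖ := by
  obtain ⟨e, he, hbe⟩ : ∃ e : ℂ, ‖e‖ = 1 ∧ b = ‖b‖ * e := by
    rcases eq_or_ne b 0 with rfl | hb
    · exact ⟨1, by simp, by simp⟩
    · have : (‖b‖ : ℂ) ≠ 0 := by simpa using hb
      exact ⟨b / ‖b‖, by simp [hb], by field_simp⟩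
  refine ⟨e, he, fun ζ hζ h1 h2 ↦ ?_⟩
  set K := √(8 * k * r + 4 * k ^ 2) with hK
  have hK0 : 0 ≤ K := sqrt_nonneg _
  have hK2 : K ^ 2 = 8 * k * r + 4 * k ^ 2 := sq_sqrt (by positivity)
  set x := ‖ζ - r * e‖ with hx
  have hx0 : 0 < x := norm_pos_iff.2 (sub_ne_zero.2 h2)
  have hx2 : x ≤ 2 * r := by
    refine (norm_sub_le _ _).trans ?_
    rw [norm_mul, he, hζ, Complex.norm_real, norm_of_nonneg hr.le]; linarith
  have hd : 0 < ‖ζ - b‖ := norm_pos_iff.2 (sub_ne_zero.2 h1)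
  have hproj : x ≤ 2 * ‖ζ - b‖ := by
    have t1 : ‖b - r * e‖ = |‖b‖ - r| := by
      nth_rw 1 [hbe]
      rw [← sub_mul, norm_mul, he, mul_one, ← Complex.ofReal_sub, Complex.norm_real]; rfl
    have t2 : |‖b‖ - r| ≤ ‖ζ - b‖ := by
      rw [← hζ, norm_sub_rev ζ b]; exact abs_norm_sub_norm_le _ _
    have t3 : x ≤ ‖ζ - b‖ + ‖b - r * e‖ := by
      have := norm_add_le (ζ - b) (b - r * e); simpa [hx] using this
    linarith
  have hpyth : x ^ 2 + K ^ 2 ≤ ‖ζ - (r + K : ℝ) * e‖ ^ 2 := by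
    have hin : (ζ * (starRingEnd ℂ) e).re ≤ r := by
      refine (Complex.re_le_norm _).trans ?_
      rw [norm_mul, Complex.norm_conj, he, hζ, mul_one]
    have hee : e.re * e.re + e.im * e.im = 1 := by
      rw [← Complex.normSq_apply, Complex.normSq_eq_norm_sq, he, one_pow]
    rw [hx, ← Complex.normSq_eq_norm_sq, ← Complex.normSq_eq_norm_sq, Complex.normSq_apply,
      Complex.normSq_apply]
    simp only [Complex.mul_re, Complex.conj_re, Complex.conj_im, Complex.sub_re, Complex.sub_im,
      Complex.ofReal_re, Complex.ofReal_im, Complex.mul_im] at hin ⊢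
    linear_combination 2 * mul_le_mul_of_nonneg_left hin hK0 - (2 * r * K + K ^ 2) * hee
  have hy0 : 0 < ‖ζ - (r + K : ℝ) * e‖ := by
    by_contra h
    have := le_antisymm (not_lt.1 h) (norm_nonneg _)
    rw [this] at hpyth; nlinarith
  rw [← log_div hy0.ne' hx0.ne']
  refine log_le_log (by positivity) ?_
  have t4 : 1 + k / ‖ζ - b‖ ≤ (x + 2 * k) / x := by
    rw [add_div, div_self hx0.ne']
    have : k / ‖ζ - b‖ ≤ 2 * k / x := by
      rw [div_le_div_iff₀ hd hx0]; nlinarith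
    linarith
  refine t4.trans ?_
  gcongr
  refine (abs_le_of_sq_le_sq' ?_ hy0.le).2
  nlinarith

lemma circleAverage_log_displacement {e : ℂ} (he : ‖e‖ = 1) {r K : ℝ} (hr : 0 < r) (hK : 0 ≤ K) :
    circleAverage (fun ζ ↦ log ‖ζ - (r + K : ℝ) * e‖ - log ‖ζ - r * e‖) 0 r ≤ K / r := by
  rw [circleAverage_fun_sub (circleIntegrable_log_norm_sub_const r)
    (circleIntegrable_log_norm_sub_const r),
    circleAverage_log_norm_sub_const_eq_log_radius_add_posLog hr.ne',
    circleAverage_log_norm_sub_const_of_mem_closedBall (by simp [he])]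
  have h1 : r⁻¹ * ‖(0 : ℂ) - (r + K : ℝ) * e‖ = 1 + K / r := by
    rw [zero_sub, norm_neg, norm_mul, he, Complex.norm_real, norm_of_nonneg (by positivity)]
    field_simp
  have h2 : 0 ≤ K / r := by positivity
  rw [h1, posLog_eq_log (by rw [abs_of_nonneg (by positivity)]; linarith)]
  have := log_le_sub_one_of_pos (show 0 < 1 + K / r by positivity)
  linarith

/-! ### Counting functions as sums over points -/

/-- The contribution of a simple point at `z` to the logarithmic counting function at radius `r`:
`log⁺ (r / |z|)`, and `log r` if `z = 0`. -/
noncomputable def countingWeight (r : ℝ) (z : ℂ) : ℝ :=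
  log⁺ (r * ‖z‖⁻¹) + if z = 0 then log r else 0

lemma countingWeight_zero (r : ℝ) : countingWeight r 0 = log r := by
  simp [countingWeight]

lemma countingWeight_of_ne {r : ℝ} {z : ℂ} (hz : z ≠ 0) :
    countingWeight r z = log⁺ (r * ‖z‖⁻¹) := by
  simp [countingWeight, hz]

lemma countingWeight_nonneg {r : ℝ} (hr : 1 ≤ r) (z : ℂ) : 0 ≤ countingWeight r z := by
  unfold countingWeight
  have := log_nonneg hr
  split_ifs <;> positivity [posLog_nonneg (x := r * ‖z‖⁻¹)]

lemma countingWeight_eq_zero {r : ℝ} (hr : 0 ≤ r) {z : ℂ} (hz : r < ‖z‖) :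
    countingWeight r z = 0 := by
  have h0 : 0 < ‖z‖ := hr.trans_lt hz
  rw [countingWeight_of_ne (norm_pos_iff.1 h0), posLog_eq_zero_iff, abs_of_nonneg (by positivity),
    ← div_eq_mul_inv]
  exact div_le_one_of_le₀ hz.le h0.le

lemma logCounting_eq_sum {D : Function.locallyFinsupp ℂ ℤ} {r : ℝ} (hr : 0 ≤ r) {S : Finset ℂ}
    (hS : ∀ z, D z ≠ 0 → ‖z‖ ≤ r → z ∈ S) :
    D.logCounting r = ∑ z ∈ S, D z * countingWeight r z := by
  have key : ∀ z, (D.toClosedBall r z : ℝ) * log (r * ‖z‖⁻¹) = D z * log⁺ (r * ‖z‖⁻¹) := by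
    intro z
    by_cases hz : ‖z‖ ≤ r
    · rw [Function.locallyFinsuppWithin.toClosedBall_eval_within _
        (by simpa [abs_of_nonneg hr] using hz)]
      rcases eq_or_ne z 0 with rfl | h0
      · simp
      · rw [posLog_eq_log]
        rw [abs_of_nonneg (by positivity), ← div_eq_mul_inv, one_le_div (norm_pos_iff.2 h0)]
        exact hz
    · have h0 : 0 < ‖z‖ := by linarith
      have h1 : log⁺ (r * ‖z‖⁻¹) = 0 := by
        rw [← countingWeight_of_ne (norm_pos_iff.1 h0), countingWeight_eq_zero hr (by linarith)]
      rw [h1, Function.locallyFinsuppWithin.apply_eq_zero_of_notMem]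
      · simp
      · simpa [abs_of_nonneg hr] using hz
  have hzero : ∀ z, z ∉ S → (D z : ℝ) * log⁺ (r * ‖z‖⁻¹) = 0 := by
    intro z hz
    by_cases hD : D z = 0
    · simp [hD]
    · have hz' : r < ‖z‖ := by
        by_contra h
        exact hz (hS z hD (not_lt.1 h))
      have h0 : 0 < ‖z‖ := hr.trans_lt hz'
      rw [← countingWeight_of_ne (norm_pos_iff.1 h0), countingWeight_eq_zero hr hz', mul_zero]
  simp only [Function.locallyFinsuppWithin.logCounting, AddMonoidHom.coe_mk, ZeroHom.coe_mk,
    countingWeight, key, mul_add, Finset.sum_add_distrib]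
  congr 1
  · refine finsum_eq_sum_of_support_subset _ fun z hz ↦ ?_
    by_contra h
    exact hz (hzero z (by simpa using h))
  · simp only [mul_ite, mul_zero, Finset.sum_ite_eq']
    split_ifs with h
    · rfl
    · have : D 0 = 0 := by
        by_contra h'
        exact h (hS 0 h' (by simpa using hr))
      simp [this]

/-- The zeros and poles in a disk, bounded by the counting functions at a larger radius. -/
lemma sum_abs_divisor_mul_log_le (g : ℂ → ℂ) {R R' : ℝ} (hR : 1 ≤ R) (hRR' : R < R')
    {S : Finset ℂ} (hS : ∀ b ∈ S, ‖b‖ ≤ R) :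
    (∑ b ∈ S, |(MeromorphicOn.divisor g univ b : ℝ)|) * log (R' / R) ≤
      logCounting g ⊤ R' + logCounting g⁻¹ ⊤ R' := by
  classical
  set D := MeromorphicOn.divisor g univ with hD
  have hfin : {z : ℂ | D z ≠ 0 ∧ ‖z‖ ≤ R'}.Finite := by
    have := (Function.locallyFinsuppWithin.toClosedBall R' D).finiteSupport
      (isCompact_closedBall 0 _)
    refine this.subset fun z hz ↦ ?_
    rw [Function.mem_support, Function.locallyFinsuppWithin.toClosedBall_eval_within]
    · exact hz.1
    · simpa [abs_of_pos (show 0 < R' by linarith)] using hz.2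
  set S' := S ∪ hfin.toFinset
  have e1 : logCounting g ⊤ R' = ∑ z ∈ S', ((D⁻ : Function.locallyFinsupp ℂ ℤ) z : ℝ) *
      countingWeight R' z := by
    rw [logCounting_top]
    refine logCounting_eq_sum (by linarith) fun z hz hz' ↦ ?_
    refine Finset.mem_union_right _ (hfin.mem_toFinset.2 ⟨fun h ↦ hz ?_, hz'⟩)
    rw [Function.locallyFinsuppWithin.negPart_apply, h, negPart_zero]
  have e2 : logCounting g⁻¹ ⊤ R' = ∑ z ∈ S', ((D⁺ : Function.locallyFinsupp ℂ ℤ) z : ℝ) *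
      countingWeight R' z := by
    rw [ValueDistribution.logCounting_inv, logCounting_zero]
    refine logCounting_eq_sum (by linarith) fun z hz hz' ↦ ?_
    refine Finset.mem_union_right _ (hfin.mem_toFinset.2 ⟨fun h ↦ hz ?_, hz'⟩)
    rw [Function.locallyFinsuppWithin.posPart_apply, h, posPart_zero]
  rw [e1, e2, ← Finset.sum_add_distrib, Finset.sum_mul]
  have h0 : ∀ z ∈ S', ((D⁻ : Function.locallyFinsupp ℂ ℤ) z : ℝ) * countingWeight R' z +
      ((D⁺ : Function.locallyFinsupp ℂ ℤ) z : ℝ) * countingWeight R' z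
      = |(D z : ℝ)| * countingWeight R' z := by
    intro z _
    rw [← add_mul, Function.locallyFinsuppWithin.negPart_apply,
      Function.locallyFinsuppWithin.posPart_apply, ← Int.cast_add, add_comm, posPart_add_negPart,
      Int.cast_abs]
  rw [Finset.sum_congr rfl h0]
  refine (Finset.sum_le_sum (g := fun z ↦ |(D z : ℝ)| * countingWeight R' z) fun b hb ↦ ?_).trans
    (Finset.sum_le_sum_of_subset_of_nonneg Finset.subset_union_left fun z _ _ ↦
      mul_nonneg (abs_nonneg _) (countingWeight_nonneg (by linarith) z))
  refine mul_le_mul_of_nonneg_left ?_ (abs_nonneg _)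
  have hpos : 0 < R' / R := by positivity [show 0 < R by linarith, show 0 < R' by linarith]
  rcases eq_or_ne b 0 with rfl | hb0
  · rw [countingWeight_zero]
    exact log_le_log hpos (div_le_self (by linarith) hR)
  · rw [countingWeight_of_ne hb0]
    refine le_trans (log_le_log hpos ?_) (le_max_right _ _)
    rw [← div_eq_mul_inv]
    have := norm_pos_iff.2 hb0
    exact div_le_div_of_nonneg_left (by linarith) this (hS b hb)

/-! ### Difference quotients -/

lemma eventually_codiscrete_of_codiscreteWithin {U : Set ℂ} (hU : IsClosed U) {p : ℂ → Prop}
    (h : ∀ᶠ z in codiscreteWithin U, p z) : ∀ᶠ z in codiscrete ℂ, z ∈ U → p z := by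
  rw [Filter.Eventually, mem_codiscrete]
  rw [Filter.Eventually, mem_codiscreteWithin] at h
  intro x
  rw [disjoint_principal_right]
  by_cases hx : x ∈ U
  · have := h x hx
    rw [disjoint_principal_right] at this
    filter_upwards [this] with z hz
    simp only [mem_compl_iff, Set.mem_sdiff, mem_ofPred_eq, not_and, not_not] at hz ⊢
    exact hz
  · filter_upwards [mem_nhdsWithin_of_mem_nhds (hU.isOpen_compl.mem_nhds hx)] with z hz
    simp only [mem_compl_iff, mem_ofPred_eq, not_not]
    exact fun h ↦ absurd h hz

/-- On a closed disk, `log |g|` is the sum of a harmonic function and of the logarithmic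
potential of the divisor of `g`, normalised to have mean value zero over the boundary. -/
lemma exists_harmonic_add_potential {g : ℂ → ℂ} (hg : Meromorphic g)
    (hg0 : ∀ z, meromorphicOrderAt g z ≠ ⊤) (R : ℝ) :
    ∃ (S : Finset ℂ) (H : ℂ → ℝ), (∀ b ∈ S, ‖b‖ ≤ R) ∧
      InnerProductSpace.HarmonicOnNhd H (closedBall 0 R) ∧
      ∀ᶠ z in codiscrete ℂ, ‖z‖ ≤ R → log ‖g z‖ = H z +
        ∑ b ∈ S, (MeromorphicOn.divisor g univ b : ℝ) * (log ‖z - b‖ - log R) := by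
  have hfin := (MeromorphicOn.divisor g (closedBall 0 R)).finiteSupport (isCompact_closedBall 0 R)
  obtain ⟨u, hu, hu0, hgu⟩ := MeromorphicOn.extract_zeros_poles (U := closedBall 0 R)
    hg.meromorphicOn (fun z ↦ hg0 z) hfin
  have hlog := eventually_codiscrete_of_codiscreteWithin isClosed_closedBall
    (MeromorphicOn.extract_zeros_poles_log hu0 hgu)
  have hmem : ∀ b ∈ hfin.toFinset, b ∈ closedBall (0 : ℂ) R := fun b hb ↦
    (MeromorphicOn.divisor g (closedBall 0 R)).supportWithinDomain (hfin.mem_toFinset.1 hb)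
  have hdiv : ∀ b ∈ hfin.toFinset, MeromorphicOn.divisor g (closedBall 0 R) b =
      MeromorphicOn.divisor g univ b := by
    intro b hb
    rw [MeromorphicOn.divisor_apply hg.meromorphicOn (hmem b hb),
      MeromorphicOn.divisor_apply hg.meromorphicOn (mem_univ b)]
  refine ⟨hfin.toFinset, (fun z ↦ log ‖u z‖) + fun _ ↦ ∑ b ∈ hfin.toFinset,
    (MeromorphicOn.divisor g univ b : ℝ) * log R, fun b hb ↦ by simpa using hmem b hb, ?_, ?_⟩
  · exact fun z hz ↦ ((hu z hz).harmonicAt_log_norm (hu0 ⟨z, hz⟩)).add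
      (InnerProductSpace.harmonicAt_const _)
  · filter_upwards [hlog] with z hz hzR
    rw [hz (by simpa using hzR)]
    have hsupp : (fun (b : ℂ) (x : ℂ) ↦
        ((MeromorphicOn.divisor g (closedBall 0 R) b : ℤ) : ℝ) * log ‖x - b‖).support ⊆
        hfin.toFinset := by
      intro b hb
      by_contra h
      refine hb ?_
      have : MeromorphicOn.divisor g (closedBall 0 R) b = 0 := by simpa using h
      ext x; simp [this]
    rw [finsum_eq_sum_of_support_subset _ hsupp]
    simp only [Pi.add_apply, Finset.sum_apply, mul_sub, Finset.sum_sub_distrib]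
    rw [Finset.sum_congr rfl fun b hb ↦ by rw [hdiv b hb]]
    ring

/-- One of the two summands bounds the increase of `log |z - b|` under the shift by `c`, the other
one its decrease. -/
lemma abs_log_norm_add_sub_le {z c b : ℂ} (h1 : z ≠ b) (h2 : z ≠ b - c) :
    |log ‖z + c - b‖ - log ‖z - b‖| ≤
      log (1 + ‖c‖ / ‖z - b‖) + log (1 + ‖c‖ / ‖z - (b - c)‖) := by
  have e : z - (b - c) = z + c - b := by ring
  have p1 : 0 < ‖z - b‖ := norm_pos_iff.2 (sub_ne_zero.2 h1)
  have p2 : 0 < ‖z + c - b‖ := by rw [← e]; exact norm_pos_iff.2 (sub_ne_zero.2 h2)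
  rw [e]
  have key : ∀ {x y : ℝ}, 0 < x → 0 < y → y ≤ x + ‖c‖ → log y - log x ≤ log (1 + ‖c‖ / x) := by
    intro x y hx hy hxy
    rw [← log_div hy.ne' hx.ne']
    refine log_le_log (by positivity) ?_
    rw [div_le_iff₀ hx, add_mul, div_mul_cancel₀ _ hx.ne', one_mul]; exact hxy
  have k1 := key p1 p2 (by
    have := norm_add_le (z - b) c; rwa [show z - b + c = z + c - b by ring] at this)
  have k2 := key p2 p1 (by
    have := norm_sub_le (z + c - b) c; rwa [show z + c - b - c = z - b by ring] at this)
  have n1 : 0 ≤ log (1 + ‖c‖ / ‖z - b‖) := log_nonneg (by simp; positivity)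
  have n2 : 0 ≤ log (1 + ‖c‖ / ‖z + c - b‖) := log_nonneg (by simp; positivity)
  rw [abs_le]; constructor <;> linarith

lemma posLog_norm_div_le (x y : ℂ) : log⁺ ‖x / y‖ ≤ |log ‖x‖ - log ‖y‖| := by
  rcases eq_or_ne x 0 with rfl | hx
  · simp
  rcases eq_or_ne y 0 with rfl | hy
  · simp
  rw [norm_div, posLog_apply, log_div (norm_ne_zero_iff.2 hx) (norm_ne_zero_iff.2 hy)]
  exact max_le (abs_nonneg _) (le_abs_self _)

/-- The difference analogue of the lemma on the logarithmic derivative, with explicit constants: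
the proximity function of `g (z + c) / g z` at radius `r`, in terms of the proximity functions of
`g` and `1 / g` at a radius `R > r + |c|` and of the number `n` of zeros and poles of modulus at
most `R`. The first summand comes from the harmonic part of `log |g|`, the second one from its
logarithmic poles. -/
lemma proximity_shift_div_le {g : ℂ → ℂ} (hg : Meromorphic g)
    (hg0 : ∀ z, meromorphicOrderAt g z ≠ ⊤) (c : ℂ) {r R R' : ℝ} (hr : 1 ≤ r)
    (hrR : r + ‖c‖ < R) (hRR' : R < R') :
    ∃ n : ℝ, 0 ≤ n ∧ n * log (R' / R) ≤ logCounting g ⊤ R' + logCounting g⁻¹ ⊤ R' ∧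
      proximity (fun z ↦ g (z + c) / g z) ⊤ r ≤
        2 * R * ‖c‖ / (R - r - ‖c‖) ^ 2 *
          (proximity g ⊤ R + proximity g⁻¹ ⊤ R + n * (2 * log 2)) +
        n * (2 * (√(8 * ‖c‖ * r + 4 * ‖c‖ ^ 2) / r)) := by
  have hc := norm_nonneg c
  have hr0 : 0 < r := by linarith
  have hR0 : 0 < R := by linarith
  obtain ⟨S, H, hS, hH, hlog⟩ := exists_harmonic_add_potential hg hg0 R
  set D : ℂ → ℝ := fun b ↦ (MeromorphicOn.divisor g univ b : ℝ) with hD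
  set K := √(8 * ‖c‖ * r + 4 * ‖c‖ ^ 2) with hK
  have hK0 : 0 ≤ K := sqrt_nonneg _
  choose e he1 he using fun b ↦ exists_log_one_add_div_le b hr0 hc
  -- the dominating function near a logarithmic pole `b`
  set V : ℂ → ℂ → ℝ := fun b ζ ↦ log ‖ζ - (r + K : ℝ) * e b‖ - log ‖ζ - r * e b‖ with hV
  have hVi : ∀ b, CircleIntegrable (V b) 0 r := fun b ↦
    (circleIntegrable_log_norm_sub_const r).sub (circleIntegrable_log_norm_sub_const r)
  have hVavg : ∀ b, circleAverage (V b) 0 r ≤ K / r := fun b ↦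
    circleAverage_log_displacement (he1 b) hr0 hK0
  have hHc : ContinuousOn H (closedBall 0 R) := fun x hx ↦
    (hH x hx).1.continuousAt.continuousWithinAt
  refine ⟨∑ b ∈ S, |D b|, Finset.sum_nonneg fun _ _ ↦ abs_nonneg _,
    sum_abs_divisor_mul_log_le g (by linarith) hRR' hS, ?_⟩
  -- on the boundary circle, `H` is `log |g|` minus the normalised potential
  have hA : circleAverage (fun ζ ↦ |H ζ|) 0 R ≤
      proximity g ⊤ R + proximity g⁻¹ ⊤ R + (∑ b ∈ S, |D b|) * (2 * log 2) := by
    have hi1 : CircleIntegrable (fun z ↦ log⁺ ‖g z‖) 0 R :=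
      MeromorphicOn.circleIntegrable_posLog_norm hg.meromorphicOn
    have hi2 : CircleIntegrable (fun z ↦ log⁺ ‖g⁻¹ z‖) 0 R :=
      MeromorphicOn.circleIntegrable_posLog_norm hg.inv.meromorphicOn
    have hi3 : ∀ b, CircleIntegrable (fun z ↦ |D b| * |log ‖z - b‖ - log R|) 0 R := fun b ↦
      (((circleIntegrable_log_norm_sub_const R).sub
        (circleIntegrable_const _ _ _)).abs).const_smul (a := |D b|)
    have hi12 : CircleIntegrable (fun z ↦ log⁺ ‖g z‖ + log⁺ ‖g⁻¹ z‖) 0 R := hi1.add hi2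
    have hi4 : CircleIntegrable (fun z ↦ ∑ b ∈ S, |D b| * |log ‖z - b‖ - log R|) 0 R := by
      have := CircleIntegrable.sum S fun b _ ↦ hi3 b
      simpa [Finset.sum_fn] using this
    have hHi : CircleIntegrable (fun ζ ↦ |H ζ|) 0 R :=
      ((hHc.mono sphere_subset_closedBall).circleIntegrable hR0.le).abs
    have h1 : circleAverage (fun ζ ↦ |H ζ|) 0 R ≤ circleAverage (fun z ↦ (log⁺ ‖g z‖ +
        log⁺ ‖g⁻¹ z‖) + ∑ b ∈ S, |D b| * |log ‖z - b‖ - log R|) 0 R := by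
      -- `H` is controlled only on the disk; its values elsewhere do not matter
      have hw : (fun z : ℂ ↦ if ‖z‖ ≤ R then |H z| else 0) =ᶠ[codiscreteWithin (sphere 0 |R|)]
          fun z ↦ |H z| := by
        refine Filter.mem_of_superset (self_mem_codiscreteWithin _) fun z hz ↦ ?_
        rw [abs_of_pos hR0, mem_sphere_zero_iff_norm] at hz
        simp [hz]
      rw [← circleAverage_congr_codiscreteWithin hw hR0.ne']
      refine circleAverage_mono_of_codiscrete hR0.ne' (hHi.congr_codiscreteWithin hw.symm)
        (hi12.add hi4) ?_
      filter_upwards [hlog] with z hz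
      have hnn : 0 ≤ ∑ b ∈ S, |D b| * |log ‖z - b‖ - log R| :=
        Finset.sum_nonneg fun b _ ↦ by positivity
      split_ifs with hzR
      · have e1 : H z = log ‖g z‖ - ∑ b ∈ S, D b * (log ‖z - b‖ - log R) := by
          rw [hz hzR]; ring
        have e2 : |log ‖g z‖| = log⁺ ‖g z‖ + log⁺ ‖g⁻¹ z‖ := by
          rw [Pi.inv_apply, norm_inv, posLog_apply, posLog_apply, log_inv]
          rcases le_total 0 (log ‖g z‖) with h | h
          · rw [abs_of_nonneg h, max_eq_right h, max_eq_left (by linarith), add_zero]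
          · rw [abs_of_nonpos h, max_eq_left h, max_eq_right (by linarith), zero_add]
        rw [e1, ← e2]
        refine (abs_sub _ _).trans (add_le_add_right ?_ _)
        refine (Finset.abs_sum_le_sum_abs _ _).trans_eq (Finset.sum_congr rfl fun b _ ↦ abs_mul _ _)
      · have := posLog_nonneg (x := ‖g z‖)
        have := posLog_nonneg (x := ‖g⁻¹ z‖)
        linarith
    refine h1.trans ?_
    rw [circleAverage_fun_add hi12 hi4, circleAverage_fun_add hi1 hi2,
      circleAverage_fun_sum fun b _ ↦ hi3 b, proximity_top, proximity_top, Finset.sum_mul]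
    gcongr with b hb
    rw [circleAverage_const_mul]
    exact mul_le_mul_of_nonneg_left (circleAverage_abs_log_sub_le (by linarith) (hS b hb))
      (abs_nonneg _)
  have hfac : 0 ≤ 2 * R * ‖c‖ / (R - r - ‖c‖) ^ 2 := by positivity
  set B := 2 * R * ‖c‖ / (R - r - ‖c‖) ^ 2 * circleAverage (fun ζ ↦ |H ζ|) 0 R with hB
  have hi5 : ∀ b, CircleIntegrable (fun z ↦ |D b| * (V b z + V (b - c) z)) 0 r := fun b ↦
    ((hVi b).add (hVi (b - c))).const_smul (a := |D b|)
  have hi6 : CircleIntegrable (fun z ↦ ∑ b ∈ S, |D b| * (V b z + V (b - c) z)) 0 r := by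
    have := CircleIntegrable.sum S fun b _ ↦ hi5 b
    simpa [Finset.sum_fn] using this
  have hgc : Meromorphic fun z ↦ g (z + c) := by
    simpa using! hg
  have hi7 : CircleIntegrable (fun z ↦ log⁺ ‖g (z + c) / g z‖) 0 r :=
    MeromorphicOn.circleIntegrable_posLog_norm (hgc.div hg).meromorphicOn
  have h2 : proximity (fun z ↦ g (z + c) / g z) ⊤ r ≤
      circleAverage (fun z ↦ B + ∑ b ∈ S, |D b| * (V b z + V (b - c) z)) 0 r := by
    rw [proximity_top]
    -- the pointwise estimate is available only on the circle `‖z‖ = r`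
    have hw : (fun z : ℂ ↦ if ‖z‖ = r then log⁺ ‖g (z + c) / g z‖ else
        B + ∑ b ∈ S, |D b| * (V b z + V (b - c) z)) =ᶠ[codiscreteWithin (sphere 0 |r|)]
          fun z ↦ log⁺ ‖g (z + c) / g z‖ := by
      refine Filter.mem_of_superset (self_mem_codiscreteWithin _) fun z hz ↦ ?_
      rw [abs_of_pos hr0, mem_sphere_zero_iff_norm] at hz
      simp [hz]
    rw [← circleAverage_congr_codiscreteWithin hw hr0.ne']
    refine circleAverage_mono_of_codiscrete hr0.ne' (hi7.congr_codiscreteWithin hw.symm)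
      ((circleIntegrable_const _ _ _).add hi6) ?_
    have hne : ∀ᶠ z : ℂ in codiscrete ℂ, ∀ b ∈ S,
        z ≠ b ∧ z ≠ b - c ∧ z ≠ r * e b ∧ z ≠ r * e (b - c) := by
      rw [Filter.eventually_all_finset]
      intro b _
      filter_upwards [compl_singleton_mem_codiscrete b, compl_singleton_mem_codiscrete (b - c),
        compl_singleton_mem_codiscrete (r * e b), compl_singleton_mem_codiscrete (r * e (b - c))]
        with z h1 h2 h3 h4 using ⟨h1, h2, h3, h4⟩
    filter_upwards [hlog, (tendsto_add_const_codiscrete c).eventually hlog, hne] with z hz hzc hzne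
    split_ifs with hzr
    swap
    · exact le_rfl
    have hzc' : ‖z + c‖ ≤ R - (R - r - ‖c‖) := (norm_add_le _ _).trans (by linarith)
    refine (posLog_norm_div_le _ _).trans ?_
    rw [hz (by linarith), hzc (by linarith)]
    have e1 : (H (z + c) + ∑ b ∈ S, D b * (log ‖z + c - b‖ - log R)) -
        (H z + ∑ b ∈ S, D b * (log ‖z - b‖ - log R)) = (H (z + c) - H z) +
          ∑ b ∈ S, D b * (log ‖z + c - b‖ - log ‖z - b‖) := by
      rw [add_sub_add_comm, ← Finset.sum_sub_distrib]
      congr 1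
      exact Finset.sum_congr rfl fun b _ ↦ by ring
    rw [e1]
    refine (abs_add_le _ _).trans (add_le_add ?_ ?_)
    · have := harmonic_sub_le (d := R - r - ‖c‖) (by linarith) hH hzc'
        (w := z) (by linarith)
      rwa [add_sub_cancel_left] at this
    · refine (Finset.abs_sum_le_sum_abs _ _).trans (Finset.sum_le_sum fun b hb ↦ ?_)
      rw [abs_mul]
      obtain ⟨n1, n2, n3, n4⟩ := hzne b hb
      exact mul_le_mul_of_nonneg_left ((abs_log_norm_add_sub_le n1 n2).trans
        (add_le_add (he b z hzr n1 n3) (he (b - c) z hzr n2 n4))) (abs_nonneg _)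
  refine h2.trans ?_
  rw [circleAverage_fun_add (circleIntegrable_const _ _ _) hi6, circleAverage_const,
    circleAverage_fun_sum fun b _ ↦ hi5 b]
  refine add_le_add (mul_le_mul_of_nonneg_left hA hfac) ?_
  rw [Finset.sum_mul]
  refine Finset.sum_le_sum fun b _ ↦ ?_
  rw [circleAverage_const_mul, circleAverage_fun_add (hVi b) (hVi _)]
  refine mul_le_mul_of_nonneg_left ?_ (abs_nonneg _)
  have := hVavg b
  have := hVavg (b - c)
  linarith

/-- The radius `r + r ^ (3/4)`. The exponent is less than one, so that passing from `r` to this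
radius at most doubles a characteristic of finite order, off a set of finite logarithmic measure;
it exceeds `2/3`, so that the lemma on difference quotients gains a power of `r`. -/
noncomputable def enlarge (r : ℝ) : ℝ := r + r ^ (3 / 4 : ℝ)

lemma rpow_le_self_of_one_le {r : ℝ} (hr : 1 ≤ r) : r ^ (3 / 4 : ℝ) ≤ r := by
  simpa using rpow_le_rpow_of_exponent_le hr (show (3 / 4 : ℝ) ≤ 1 by norm_num)

lemma self_le_enlarge {r : ℝ} (hr : 0 ≤ r) : r ≤ enlarge r := by
  unfold enlarge; have := rpow_nonneg hr (3 / 4 : ℝ); linarith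

lemma enlarge_le {r : ℝ} (hr : 1 ≤ r) : enlarge r ≤ 2 * r := by
  unfold enlarge; have := rpow_le_self_of_one_le hr; linarith

lemma tendsto_enlarge : Tendsto enlarge atTop atTop :=
  tendsto_atTop_mono' _ ((eventually_ge_atTop 0).mono fun _ hr ↦ self_le_enlarge hr) tendsto_id

lemma T_nonneg (f : ℂ → ℂ) {r : ℝ} (hr : 1 ≤ r) : 0 ≤ T f r := characteristic_nonneg hr

/-- Here `proximity_shift_div_le` is applied with the radii `R = r + h / 2` and `R' = r + h`, where
`h = r ^ (3/4)`. There are `O (T (R') r / h)` zeros and poles in the disk of radius `R`; the harmonic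
part contributes `O (T (R') r ^ 2 / h ^ 3)`, and the poles `O (T (R') r ^ (1/2) / h)`. -/
lemma exists_proximity_shift_div_le {g : ℂ → ℂ} (hg : Meromorphic g)
    (hg0 : ∀ z, meromorphicOrderAt g z ≠ ⊤) (c : ℂ) :
    ∃ C : ℝ, ∀ᶠ r in atTop, proximity (fun z ↦ g (z + c) / g z) ⊤ r ≤
      C * (r ^ (-(1 / 4) : ℝ) * (T g (enlarge r) + 1)) := by
  set k := ‖c‖ with hk
  have hk0 : 0 ≤ k := norm_nonneg c
  set C₀ := max |log ‖g 0‖| |log ‖meromorphicTrailingCoeffAt g 0‖| with hC₀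
  have hC₀0 : 0 ≤ C₀ := le_max_of_le_left (abs_nonneg _)
  refine ⟨(576 * k + 8 * √(12 * k)) * (C₀ + 2), ?_⟩
  have hev : ∀ᶠ r : ℝ in atTop, 4 * k + 1 ≤ r ^ (3 / 4 : ℝ) :=
    (tendsto_rpow_atTop (by norm_num : (0 : ℝ) < 3 / 4)).eventually_ge_atTop _
  filter_upwards [hev, eventually_ge_atTop 1] with r hh hr
  have hr0 : 0 < r := by linarith
  have hhr := rpow_le_self_of_one_le hr
  have hR'def : enlarge r = r + r ^ (3 / 4 : ℝ) := rfl
  set h := r ^ (3 / 4 : ℝ) with hh_def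
  have hh0 : 0 < h := by linarith
  set R' := enlarge r with hR'
  set R := r + h / 2 with hR
  have hRR' : R < R' := by linarith
  obtain ⟨n, hn0, hn, hprox⟩ := proximity_shift_div_le hg hg0 c hr
    (show r + ‖c‖ < R by linarith) hRR'
  set B := T g R' + T g⁻¹ R' with hB
  have hTg : 0 ≤ T g R' := T_nonneg _ (by linarith)
  have hTg' : 0 ≤ T g⁻¹ R' := T_nonneg _ (by linarith)
  have hB0 : 0 ≤ B := by positivity
  have hBle : B ≤ (C₀ + 2) * (T g R' + 1) := by
    have h1 := characteristic_sub_characteristic_inv_le hg (R := R')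
    have h2 := (abs_le.1 h1).1
    have h3 : T g⁻¹ R' ≤ T g R' + C₀ := by unfold T; linarith
    nlinarith
  have hmono : ∀ {q : ℂ → ℂ}, Meromorphic q → proximity q ⊤ R ≤ T q R' := by
    intro q hq
    have h1 : characteristic q ⊤ R ≤ characteristic q ⊤ R' :=
      characteristic_monotoneOn hq (show (0 : ℝ) < R by linarith) (show (0 : ℝ) < R' by linarith)
        hRR'.le
    have h2 : 0 ≤ logCounting q ⊤ R := logCounting_nonneg (by linarith)
    simp only [characteristic, Pi.add_apply] at h1
    unfold T
    simp only [characteristic, Pi.add_apply]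
    linarith
  have hm : proximity g ⊤ R + proximity g⁻¹ ⊤ R ≤ B := add_le_add (hmono hg) (hmono hg.inv)
  have hN : logCounting g ⊤ R' + logCounting g⁻¹ ⊤ R' ≤ B := by
    have h1 := proximity_nonneg (f := g) (a := ⊤) R'
    have h2 := proximity_nonneg (f := g⁻¹) (a := ⊤) R'
    simp only [hB, T, characteristic, Pi.add_apply, Pi.zero_apply] at h1 h2 ⊢
    linarith
  have hlog : h / (4 * r) ≤ log (R' / R) := by
    refine le_trans ?_ (one_sub_inv_le_log_of_pos (div_pos (by linarith) (by linarith)))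
    rw [inv_div, one_sub_div (by linarith), div_le_div_iff₀ (by linarith) (by linarith)]
    nlinarith
  have hnB : n ≤ B * (4 * r / h) := by
    have : n * (h / (4 * r)) ≤ B := (mul_le_mul_of_nonneg_left hlog hn0).trans (hn.trans hN)
    rw [← div_le_iff₀ (by positivity)]
    refine le_trans (le_of_eq ?_) this
    field_simp
  have hlog2 : log 2 ≤ 1 := by have := log_two_lt_d9; linarith
  have h1rh : 1 ≤ r / h := by rw [one_le_div hh0]; exact hhr
  have hsum : proximity g ⊤ R + proximity g⁻¹ ⊤ R + n * (2 * log 2) ≤ 9 * (B * (r / h)) := by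
    have e1 : n * (2 * log 2) ≤ B * (4 * r / h) * 2 :=
      mul_le_mul hnB (by linarith) (by positivity) (by positivity)
    have e2 : B ≤ B * (r / h) := le_mul_of_one_le_right hB0 h1rh
    have e3 : B * (4 * r / h) * 2 = 8 * (B * (r / h)) := by ring
    linarith
  have hcoef : 2 * R * ‖c‖ / (R - r - ‖c‖) ^ 2 ≤ 64 * k * (r / h ^ 2) := by
    have hd : h / 4 ≤ R - r - ‖c‖ := by linarith
    have : 2 * R * ‖c‖ / (R - r - ‖c‖) ^ 2 ≤ 2 * (2 * r) * k / (h / 4) ^ 2 := by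
      gcongr; linarith
    refine this.trans_eq ?_
    field_simp
    ring
  have hK : √(8 * ‖c‖ * r + 4 * ‖c‖ ^ 2) ≤ √(12 * k) * √r := by
    rw [← sqrt_mul (by positivity)]
    refine sqrt_le_sqrt ?_
    rw [← hk]; nlinarith
  have hp1 : r ^ 2 / h ^ 3 = r ^ (-(1 / 4) : ℝ) := by
    rw [hh_def, ← rpow_natCast, ← rpow_natCast, ← rpow_mul hr0.le, ← rpow_sub hr0]; norm_num
  have hp2 : √r / h = r ^ (-(1 / 4) : ℝ) := by
    rw [hh_def, sqrt_eq_rpow, ← rpow_sub hr0]; norm_num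
  set ρ := r ^ (-(1 / 4) : ℝ) with hρ
  have hρ0 : 0 ≤ ρ := by positivity
  have hS0 : 0 ≤ proximity g ⊤ R + proximity g⁻¹ ⊤ R + n * (2 * log 2) := by
    have h1 := proximity_nonneg (f := g) (a := ⊤) R
    have h2 := proximity_nonneg (f := g⁻¹) (a := ⊤) R
    simp only [Pi.zero_apply] at h1 h2
    positivity
  calc proximity (fun z ↦ g (z + c) / g z) ⊤ r
      ≤ 64 * k * (r / h ^ 2) * (9 * (B * (r / h))) +
        B * (4 * r / h) * (2 * (√(12 * k) * √r / r)) := by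
        refine hprox.trans (add_le_add ?_ ?_)
        · exact mul_le_mul hcoef hsum hS0 (by positivity)
        · exact mul_le_mul hnB (by gcongr) (by positivity) (by positivity)
    _ = (576 * k * (r ^ 2 / h ^ 3) + 8 * √(12 * k) * (√r / h)) * B := by
        field_simp
        ring
    _ = (576 * k + 8 * √(12 * k)) * ρ * B := by rw [hp1, hp2]; ring
    _ ≤ (576 * k + 8 * √(12 * k)) * ρ * ((C₀ + 2) * (T g R' + 1)) := by gcongr
    _ = _ := by ring

lemma proximity_shift_div_isLittleO {g : ℂ → ℂ} (hg : Meromorphic g)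
    (hg0 : ∀ z, meromorphicOrderAt g z ≠ ⊤) (c : ℂ) :
    (fun r ↦ proximity (fun z ↦ g (z + c) / g z) ⊤ r) =o[atTop]
      fun r ↦ T g (enlarge r) + 1 := by
  obtain ⟨C, hC⟩ := exists_proximity_shift_div_le hg hg0 c
  have h1 : (fun r ↦ proximity (fun z ↦ g (z + c) / g z) ⊤ r) =O[atTop]
      fun r ↦ r ^ (-(1 / 4) : ℝ) * (T g (enlarge r) + 1) := by
    refine IsBigO.of_bound C ?_
    filter_upwards [hC, eventually_ge_atTop 1] with r h hr
    have h2 := T_nonneg g (hr.trans (self_le_enlarge (by linarith)))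
    have h3 := proximity_nonneg (f := fun z ↦ g (z + c) / g z) (a := ⊤) r
    rw [Real.norm_of_nonneg (by simpa using h3), Real.norm_of_nonneg (by positivity)]
    exact h
  refine h1.trans_isLittleO ?_
  have h4 : (fun r : ℝ ↦ r ^ (-(1 / 4) : ℝ)) =o[atTop] fun _ ↦ (1 : ℝ) := by
    rw [isLittleO_one_iff]
    exact tendsto_rpow_neg_atTop (by norm_num)
  simpa using h4.mul_isBigO (isBigO_refl (fun r ↦ T g (enlarge r) + 1) atTop)

/-! ### The characteristic of a shifted function -/

/-- The contribution of a point to the counting function of a translate. Away from the centre `c`,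
`r / |z - c| ≤ ((r + h) / |z|) ^ 2`, which explains the factor two; the points near `c`, finitely
many in each application, contribute a bounded error. -/
lemma countingWeight_sub_le {r h : ℝ} (hr : 1 ≤ r) {c : ℂ} (hh : ‖c‖ + ‖c‖ ^ 2 ≤ h) (z : ℂ) :
    countingWeight r (z - c) ≤ 2 * countingWeight (r + h) z +
      if ‖z - c‖ < 1 then log⁺ ‖z‖ + |log ‖z - c‖| else 0 := by
  have hk := norm_nonneg c
  have hh0 : 0 ≤ h := by nlinarith
  have hW := countingWeight_nonneg (show 1 ≤ r + h by linarith) z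
  have hlogr : log r ≤ log (r + h) := log_le_log (by linarith) (by linarith)
  have hlogr0 := log_nonneg hr
  split_ifs with hx
  · have h1 : countingWeight r (z - c) ≤ log r + |log ‖z - c‖| := by
      rcases eq_or_ne (z - c) 0 with h0 | h0
      · rw [h0, countingWeight_zero]; simp
      · rw [countingWeight_of_ne h0]
        refine posLog_mul.trans (add_le_add ?_ ?_)
        · rw [posLog_apply]; exact max_le hlogr0 le_rfl
        · rw [posLog_apply, log_inv]; exact max_le (abs_nonneg _) (neg_le_abs _)
    have h2 : log r ≤ countingWeight (r + h) z + log⁺ ‖z‖ := by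
      rcases eq_or_ne z 0 with rfl | h0
      · rw [countingWeight_zero]; simpa using hlogr
      · rw [countingWeight_of_ne h0]
        refine hlogr.trans ((le_max_right 0 _).trans ?_)
        rw [← posLog_apply]
        have e : r + h = (r + h) * ‖z‖⁻¹ * ‖z‖ := by
          rw [mul_assoc, inv_mul_cancel₀ (norm_ne_zero_iff.2 h0), mul_one]
        nth_rw 1 [e]
        exact posLog_mul
    linarith
  · rw [add_zero]
    have hx1 : 1 ≤ ‖z - c‖ := not_lt.1 hx
    set x := ‖z - c‖
    by_cases hrx : r < x
    · rw [countingWeight_eq_zero (by linarith) hrx]; linarith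
    have hzc : z - c ≠ 0 := norm_pos_iff.1 (show 0 < ‖z - c‖ by linarith)
    have hq : 1 ≤ r * x⁻¹ := by
      rw [← div_eq_mul_inv, one_le_div (by linarith)]; exact not_lt.1 hrx
    rw [countingWeight_of_ne hzc, posLog_eq_log (by rwa [abs_of_nonneg (by linarith)])]
    rcases eq_or_ne z 0 with h0 | h0
    · rw [show countingWeight (r + h) z = log (r + h) by rw [h0, countingWeight_zero]]
      have : log (r * x⁻¹) ≤ log r := by
        refine log_le_log (by linarith) (mul_le_of_le_one_right (by linarith) ?_)
        exact inv_le_one_of_one_le₀ hx1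
      linarith
    · rw [countingWeight_of_ne h0]
      have hz0 : 0 < ‖z‖ := norm_pos_iff.2 h0
      have hzx : ‖z‖ ≤ x + ‖c‖ := by
        have := norm_add_le (z - c) c; rwa [sub_add_cancel] at this
      have hmain : log (r * x⁻¹) ≤ 2 * log ((r + h) * ‖z‖⁻¹) := by
        rw [← Nat.cast_ofNat, ← log_pow]
        refine log_le_log (by linarith) ?_
        rw [← div_eq_mul_inv, ← div_eq_mul_inv, div_pow, div_le_div_iff₀ (by linarith)
          (by positivity)]
        have a1 : ‖z‖ ^ 2 ≤ (x + ‖c‖) ^ 2 := by gcongr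
        have a2 : r * (x + ‖c‖) ^ 2 ≤ x * (r ^ 2 + 2 * r * ‖c‖ + 2 * r * ‖c‖ ^ 2) := by
          have b1 : r * x * x ≤ r * x * r := by gcongr; exact not_lt.1 hrx
          have b2 : r * ‖c‖ ^ 2 * 1 ≤ r * ‖c‖ ^ 2 * x := by gcongr
          have b3 : 0 ≤ r * ‖c‖ ^ 2 * x := by positivity
          nlinarith
        have a3 : r ^ 2 + 2 * r * ‖c‖ + 2 * r * ‖c‖ ^ 2 ≤ (r + h) ^ 2 := by nlinarith
        calc r * ‖z‖ ^ 2 ≤ r * (x + ‖c‖) ^ 2 := by gcongr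
          _ ≤ x * (r ^ 2 + 2 * r * ‖c‖ + 2 * r * ‖c‖ ^ 2) := a2
          _ ≤ x * (r + h) ^ 2 := by gcongr
          _ = _ := by ring
      refine hmain.trans ?_
      gcongr
      exact le_max_right _ _

lemma exists_logCounting_translate_le {D D' : Function.locallyFinsupp ℂ ℤ} (hD : 0 ≤ D) {c : ℂ}
    (hD' : ∀ z, D' z = D (z + c)) :
    ∃ C : ℝ, ∀ᶠ r in atTop, D'.logCounting r ≤ 2 * D.logCounting (enlarge r) + C := by
  classical
  have hfin : ∀ ρ : ℝ, {z : ℂ | D z ≠ 0 ∧ ‖z‖ ≤ ρ}.Finite := by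
    intro ρ
    refine ((D.toClosedBall ρ).finiteSupport (isCompact_closedBall 0 _)).subset fun z hz ↦ ?_
    rw [Function.mem_support, Function.locallyFinsuppWithin.toClosedBall_eval_within]
    · exact hz.1
    · simpa using hz.2.trans (le_abs_self _)
  have hDn : ∀ z, 0 ≤ (D z : ℝ) := fun z ↦ Int.cast_nonneg (hD z)
  set κ : ℂ → ℝ := fun z ↦ if ‖z - c‖ < 1 then log⁺ ‖z‖ + |log ‖z - c‖| else 0 with hκ
  have hκ0 : ∀ z, 0 ≤ κ z := by
    intro z
    simp only [hκ]
    split_ifs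
    · have := posLog_nonneg (x := ‖z‖); positivity
    · exact le_rfl
  set S₀ := (hfin (‖c‖ + 1)).toFinset
  refine ⟨∑ z ∈ S₀, D z * κ z, ?_⟩
  have hev : ∀ᶠ r : ℝ in atTop, ‖c‖ + ‖c‖ ^ 2 ≤ r ^ (3 / 4 : ℝ) :=
    (tendsto_rpow_atTop (by norm_num : (0 : ℝ) < 3 / 4)).eventually_ge_atTop _
  filter_upwards [hev, eventually_ge_atTop 1] with r hh hr
  have hr0 : 0 ≤ r := by linarith
  set S := (hfin (enlarge r)).toFinset
  have hck := norm_nonneg c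
  have e1 : D.logCounting (enlarge r) = ∑ z ∈ S, D z * countingWeight (enlarge r) z :=
    logCounting_eq_sum (hr0.trans (self_le_enlarge hr0)) fun z h1 h2 ↦
      (hfin (enlarge r)).mem_toFinset.2 ⟨h1, h2⟩
  have e2 : D'.logCounting r = ∑ z ∈ S, D z * countingWeight r (z - c) := by
    rw [logCounting_eq_sum (S := S.image (· - c)) hr0]
    · rw [Finset.sum_image fun x _ y _ hxy ↦ sub_left_injective hxy]
      exact Finset.sum_congr rfl fun z _ ↦ by rw [hD', sub_add_cancel]
    · intro z h1 h2
      refine Finset.mem_image.2 ⟨z + c, (hfin (enlarge r)).mem_toFinset.2 ⟨by rwa [← hD'], ?_⟩,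
        add_sub_cancel_right z c⟩
      refine (norm_add_le _ _).trans ?_
      unfold enlarge; nlinarith
  have e3 : ∑ z ∈ S, D z * κ z ≤ ∑ z ∈ S₀, D z * κ z := by
    rw [← Finset.sum_filter_add_sum_filter_not S (fun z ↦ z ∈ S₀)]
    have h0 : ∑ z ∈ S with z ∉ S₀, D z * κ z = 0 := by
      refine Finset.sum_eq_zero fun z hz ↦ ?_
      obtain ⟨h1, h2⟩ := Finset.mem_filter.1 hz
      have h3 : D z ≠ 0 := ((hfin _).mem_toFinset.1 h1).1
      have h4 : ¬ ‖z‖ ≤ ‖c‖ + 1 := fun h ↦ h2 ((hfin _).mem_toFinset.2 ⟨h3, h⟩)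
      have h5 : ¬ ‖z - c‖ < 1 := by
        have := norm_sub_norm_le z c; intro h; linarith
      simp [hκ, h5]
    rw [h0, add_zero]
    exact Finset.sum_le_sum_of_subset_of_nonneg (fun z hz ↦ (Finset.mem_filter.1 hz).2)
      fun z _ _ ↦ mul_nonneg (hDn z) (hκ0 z)
  rw [e1, e2, Finset.mul_sum]
  refine le_trans ?_ (add_le_add_right e3 _)
  rw [← Finset.sum_add_distrib]
  refine Finset.sum_le_sum fun z _ ↦ ?_
  have := mul_le_mul_of_nonneg_left (countingWeight_sub_le hr hh z) (hDn z)
  refine this.trans_eq ?_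
  simp only [hκ, enlarge]
  ring

/-- The identity principle: a meromorphic function vanishes identically or nowhere locally. -/
lemma eq_zero_or_meromorphicOrderAt_ne_top {g : ℂ → ℂ} (hg : Meromorphic g) :
    g =ᶠ[codiscrete ℂ] 0 ∨ ∀ z, meromorphicOrderAt g z ≠ ⊤ := by
  by_cases h : ∃ z, meromorphicOrderAt g z ≠ ⊤
  · exact Or.inr (hg.exists_meromorphicOrderAt_ne_top_iff_forall.1 h)
  · push Not at h
    left
    rw [Filter.EventuallyEq, Filter.Eventually, mem_codiscrete]
    intro x
    rw [disjoint_principal_right, compl_compl]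
    exact meromorphicOrderAt_eq_top_iff.1 (h x)

lemma eventually_ne_zero {g : ℂ → ℂ} (hg : Meromorphic g)
    (hg0 : ∀ z, meromorphicOrderAt g z ≠ ⊤) : ∀ᶠ z in codiscrete ℂ, g z ≠ 0 := by
  exact hg.meromorphicOn.eventually_codiscreteWithin_apply_ne_zero fun z _ ↦ hg0 z

lemma T_congr {f g : ℂ → ℂ} (h : f =ᶠ[codiscrete ℂ] g) {r : ℝ} (hr : r ≠ 0) : T f r = T g r :=
  characteristic_congr_codiscrete h hr

lemma T_zero (r : ℝ) : T 0 r = 0 := by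
  have h : logCounting (0 : ℂ → ℂ) ⊤ = 0 := logCounting_const_zero
  simp [T, characteristic, proximity_top, h, circleAverage_const]

lemma meromorphic_shift {g : ℂ → ℂ} (hg : Meromorphic g) (c : ℂ) :
    Meromorphic fun z ↦ g (z + c) := by
  simpa using! hg

/-- The characteristic of a shift; the proximity function is treated by writing
`a (z + c) = a z * (a (z + c) / a z)`. -/
lemma T_shift_isBigO {a : ℂ → ℂ} (ha : Meromorphic a) (c : ℂ) :
    (fun r ↦ T (fun z ↦ a (z + c)) r) =O[atTop] fun r ↦ T a (enlarge r) + 1 := by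
  rcases eq_zero_or_meromorphicOrderAt_ne_top ha with h0 | h0
  · have h1 : (fun z ↦ a (z + c)) =ᶠ[codiscrete ℂ] 0 :=
      (tendsto_add_const_codiscrete c).eventually h0
    refine IsBigO.of_bound 1 ?_
    filter_upwards [eventually_ne_atTop 0] with r hr
    rw [T_congr h1 hr, T_zero, norm_zero]
    positivity
  have hTe : ∀ᶠ r in atTop, 0 ≤ T a (enlarge r) := by
    filter_upwards [eventually_ge_atTop 1] with r hr
    exact T_nonneg a (hr.trans (self_le_enlarge (by linarith)))
  have hN : (fun r ↦ logCounting (fun z ↦ a (z + c)) ⊤ r) =O[atTop]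
      fun r ↦ T a (enlarge r) + 1 := by
    obtain ⟨C, hC⟩ := exists_logCounting_translate_le
      (D := (MeromorphicOn.divisor a univ)⁻)
      (D' := (MeromorphicOn.divisor (fun z ↦ a (z + c)) univ)⁻) (negPart_nonneg _) (c := c) (by
        intro z
        rw [Function.locallyFinsuppWithin.negPart_apply, Function.locallyFinsuppWithin.negPart_apply,
          MeromorphicOn.divisor_apply ha.meromorphicOn (mem_univ _),
          MeromorphicOn.divisor_apply (meromorphic_shift ha c).meromorphicOn (mem_univ _)]
        congr 2
        exact meromorphicOrderAt_comp_add_const_eq_meromorphicOrderAt)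
    refine IsBigO.of_bound (2 + |C|) ?_
    filter_upwards [hC, hTe, eventually_ge_atTop 1] with r h1 h2 hr
    have h3 : 0 ≤ logCounting (fun z ↦ a (z + c)) ⊤ r := logCounting_nonneg hr
    have h4 : logCounting a ⊤ (enlarge r) ≤ T a (enlarge r) := by
      have := proximity_nonneg (f := a) (a := ⊤) (enlarge r)
      simp only [T, characteristic, Pi.add_apply, Pi.zero_apply] at this ⊢
      linarith
    rw [Real.norm_of_nonneg h3, Real.norm_of_nonneg (by positivity)]
    rw [← logCounting_top, ← logCounting_top] at h1
    nlinarith [le_abs_self C, abs_nonneg C]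
  have hm1 : (fun r ↦ proximity a ⊤ r) =O[atTop] fun r ↦ T a (enlarge r) + 1 := by
    refine IsBigO.of_bound 1 ?_
    filter_upwards [hTe, eventually_ge_atTop 1] with r h2 hr
    have h3 : characteristic a ⊤ r ≤ T a (enlarge r) :=
      characteristic_monotoneOn ha (show (0 : ℝ) < r by linarith)
        (show (0 : ℝ) < enlarge r by linarith [self_le_enlarge (show 0 ≤ r by linarith)])
        (self_le_enlarge (by linarith))
    have h4 : 0 ≤ logCounting a ⊤ r := logCounting_nonneg hr
    have h5 := proximity_nonneg (f := a) (a := ⊤) r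
    simp only [characteristic, Pi.add_apply, Pi.zero_apply] at h3 h5
    rw [Real.norm_of_nonneg h5, Real.norm_of_nonneg (by positivity)]
    linarith
  have hm : (fun r ↦ proximity (fun z ↦ a (z + c)) ⊤ r) =O[atTop]
      fun r ↦ T a (enlarge r) + 1 := by
    refine IsBigO.trans ?_ (hm1.add (proximity_shift_div_isLittleO ha h0 c).isBigO)
    refine IsBigO.of_bound 1 ?_
    filter_upwards [eventually_ne_atTop 0] with r hr
    have e : (fun z ↦ a (z + c)) =ᶠ[codiscrete ℂ] a * fun z ↦ a (z + c) / a z := by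
      filter_upwards [eventually_ne_zero ha h0] with z hz
      rw [Pi.mul_apply, mul_div_cancel₀ _ hz]
    have h1 := proximity_nonneg (f := fun z ↦ a (z + c)) (a := ⊤) r
    have h2 := proximity_mul_top_le ha ((meromorphic_shift ha c).div ha) r
    rw [Real.norm_of_nonneg h1, one_mul]
    rw [proximity_congr_codiscrete e hr]
    exact h2.trans (le_abs_self _)
  exact hm.add hN

/-! ### Sets of finite logarithmic measure -/

namespace FiniteLogMeasure

lemma union {E F : Set ℝ} (hE : FiniteLogMeasure E) (hF : FiniteLogMeasure F) :
    FiniteLogMeasure (E ∪ F) :=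
  ⟨hE.1.union hF.1, union_subset hE.2.1 hF.2.1,
    (lintegral_union_le _ _ _).trans_lt (ENNReal.add_lt_top.2 ⟨hE.2.2, hF.2.2⟩)⟩

lemma empty : FiniteLogMeasure ∅ := ⟨MeasurableSet.empty, empty_subset _, by simp⟩

lemma biUnion {ι : Type*} (s : Finset ι) {E : ι → Set ℝ}
    (h : ∀ i ∈ s, FiniteLogMeasure (E i)) : FiniteLogMeasure (⋃ i ∈ s, E i) := by
  classical
  induction s using Finset.induction with
  | empty => simpa using empty
  | insert i s _ ih =>
    rw [Finset.set_biUnion_insert]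
    exact (h i (Finset.mem_insert_self _ _)).union
      (ih fun j hj ↦ h j (Finset.mem_insert_of_mem hj))

end FiniteLogMeasure

lemma atTopOff_anti {E F : Set ℝ} (h : E ⊆ F) : atTopOff F ≤ atTopOff E :=
  inf_le_inf le_rfl (principal_mono.2 (compl_subset_compl.2 h))

lemma atTopOff_le (E : Set ℝ) : atTopOff E ≤ atTop := inf_le_left

lemma FiniteLogMeasure.atTopOff_neBot {E : Set ℝ} (hE : FiniteLogMeasure E) :
    (atTopOff E).NeBot := by
  rw [atTopOff, Filter.inf_principal_neBot_iff]
  intro U hU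
  obtain ⟨r₀, hr₀⟩ := mem_atTop_sets.1 hU
  by_contra h
  have hsub : Ioi (max r₀ 1) ⊆ E := by
    intro r hr
    by_contra hrE
    exact h ⟨r, hr₀ r ((le_max_left _ _).trans (le_of_lt hr)), hrE⟩
  refine not_integrableOn_Ioi_inv (a := max r₀ 1) ⟨by fun_prop, ?_⟩
  rw [hasFiniteIntegral_iff_enorm]
  refine lt_of_le_of_lt ?_ hE.2.2
  refine (setLIntegral_mono' measurableSet_Ioi fun r hr ↦ ?_).trans (lintegral_mono_set hsub)
  have hr0 : 0 < r := lt_of_lt_of_le one_pos ((le_max_right r₀ 1).trans (le_of_lt hr))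
  rw [one_div, ← Real.enorm_of_nonneg (by positivity)]

/-- Substituting `s = r + r ^ (3/4)`, whose derivative is at least one and which satisfies
`s ≤ 2 r`, increases the logarithmic measure at most by a factor two. -/
lemma FiniteLogMeasure.preimage_enlarge {E : Set ℝ} (hE : FiniteLogMeasure E) :
    FiniteLogMeasure {r | 1 ≤ r ∧ enlarge r ∈ E} := by
  have hmeas : Measurable enlarge := by unfold enlarge; fun_prop
  set G := {r | 1 ≤ r ∧ enlarge r ∈ E} with hG
  have hGm : MeasurableSet G := measurableSet_Ici.inter (hmeas hE.1)
  refine ⟨hGm, fun r hr ↦ lt_of_lt_of_le one_pos hr.1, ?_⟩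
  have hder : ∀ r ∈ G, HasDerivWithinAt enlarge (1 + 3 / 4 * r ^ (3 / 4 - 1 : ℝ)) G r := by
    intro r hr
    have hr0 : r ≠ 0 := (lt_of_lt_of_le one_pos hr.1).ne'
    exact ((hasDerivAt_id r).add (hasDerivAt_rpow_const (Or.inl hr0))).hasDerivWithinAt
  have hinj : InjOn enlarge G := by
    have : StrictMonoOn enlarge G := by
      intro x hx y hy hxy
      have h1 : x ^ (3 / 4 : ℝ) ≤ y ^ (3 / 4 : ℝ) :=
        rpow_le_rpow (by linarith [hx.1]) hxy.le (by norm_num)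
      unfold enlarge; linarith
    exact this.injOn
  have hcov := lintegral_image_eq_lintegral_abs_deriv_mul hGm hder hinj
    (fun s ↦ ENNReal.ofReal (1 / s))
  have himg : enlarge '' G ⊆ E := by rintro _ ⟨r, hr, rfl⟩; exact hr.2
  calc ∫⁻ r in G, ENNReal.ofReal (1 / r)
      ≤ ∫⁻ r in G, 2 * (ENNReal.ofReal |1 + 3 / 4 * r ^ (3 / 4 - 1 : ℝ)| *
          ENNReal.ofReal (1 / enlarge r)) := by
        refine setLIntegral_mono' hGm fun r hr ↦ ?_
        have hr1 : 1 ≤ r := hr.1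
        have hp : 0 ≤ r ^ (3 / 4 - 1 : ℝ) := rpow_nonneg (by linarith) _
        have he : 0 < enlarge r := by linarith [self_le_enlarge (show 0 ≤ r by linarith)]
        rw [← ENNReal.ofReal_mul (abs_nonneg _), show (2 : ENNReal) = ENNReal.ofReal 2 by simp,
          ← ENNReal.ofReal_mul (by norm_num)]
        refine ENNReal.ofReal_le_ofReal ?_
        rw [abs_of_nonneg (by positivity), mul_one_div, mul_div_assoc',
          div_le_div_iff₀ (by linarith) he]
        have := enlarge_le hr1
        nlinarith
    _ = 2 * ∫⁻ s in enlarge '' G, ENNReal.ofReal (1 / s) := by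
        rw [hcov, lintegral_const_mul' _ _ (by simp)]
    _ ≤ 2 * ∫⁻ s in E, ENNReal.ofReal (1 / s) := by gcongr
    _ < ⊤ := ENNReal.mul_lt_top (by simp) hE.2.2

lemma tendsto_enlarge_atTopOff {E F : Set ℝ} (h : {r | 1 ≤ r ∧ enlarge r ∈ E} ⊆ F) :
    Tendsto enlarge (atTopOff F) (atTopOff E) := by
  refine tendsto_inf.2 ⟨tendsto_enlarge.mono_left (atTopOff_le F), tendsto_principal.2 ?_⟩
  have h1 : ∀ᶠ r in atTopOff F, 1 ≤ r := (eventually_ge_atTop 1).filter_mono (atTopOff_le F)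
  have h2 : ∀ᶠ r in atTopOff F, r ∈ Fᶜ := Filter.Eventually.filter_mono inf_le_right
    (mem_principal_self _)
  filter_upwards [h1, h2] with r hr hrF hrE
  exact hrF (h ⟨hr, hrE⟩)

/-! ### Growth of functions of finite order -/

/-- The telescoping estimate behind the growth lemma: the increments `L (r + h) - L r` have
integral at most `h * sup L`, so they are seldom large. -/
lemma log_two_mul_volume_le {L : ℝ → ℝ} (hL : Monotone L) (hL0 : ∀ r, 0 ≤ L r) {A h : ℝ}
    (hA : 0 ≤ A) (hh : 0 ≤ h) :
    log 2 * (volume.restrict (Icc A (2 * A))).real {r | log 2 ≤ L (r + h) - L r} ≤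
      h * L (2 * A + h) := by
  have hLi : ∀ a b, IntervalIntegrable L volume a b := fun a b ↦ hL.intervalIntegrable
  have hLhi : ∀ a b, IntervalIntegrable (fun r ↦ L (r + h)) volume a b := fun a b ↦
    (show Monotone fun r ↦ L (r + h) from fun x y hxy ↦ hL (by linarith)).intervalIntegrable
  have hAA : A ≤ 2 * A := by linarith
  have hint : IntegrableOn (fun r ↦ L (r + h) - L r) (Icc A (2 * A)) := by
    rw [integrableOn_Icc_iff_integrableOn_Ioc, ← intervalIntegrable_iff_integrableOn_Ioc_of_le hAA]
    exact (hLhi _ _).sub (hLi _ _)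
  refine (mul_meas_ge_le_integral_of_nonneg (ae_of_all _ fun r ↦ ?_) hint (log 2)).trans ?_
  · have := hL (show r ≤ r + h by linarith)
    simp only [Pi.zero_apply]; linarith
  rw [integral_Icc_eq_integral_Ioc, ← intervalIntegral.integral_of_le hAA,
    intervalIntegral.integral_sub (hLhi _ _) (hLi _ _),
    intervalIntegral.integral_comp_add_right (fun r ↦ L r) h]
  have e1 : (∫ x in A + h..2 * A + h, L x) - ∫ x in A..2 * A, L x =
      (∫ x in 2 * A..2 * A + h, L x) - ∫ x in A..A + h, L x := by
    have h1 := intervalIntegral.integral_add_adjacent_intervals (hLi A (A + h))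
      (hLi (A + h) (2 * A + h))
    have h2 := intervalIntegral.integral_add_adjacent_intervals (hLi A (2 * A))
      (hLi (2 * A) (2 * A + h))
    linarith
  have e2 : 0 ≤ ∫ x in A..A + h, L x :=
    intervalIntegral.integral_nonneg (by linarith) fun x _ ↦ hL0 x
  have e3 : ∫ x in 2 * A..2 * A + h, L x ≤ ∫ x in 2 * A..2 * A + h, L (2 * A + h) :=
    intervalIntegral.integral_mono_on (by linarith) (hLi _ _) intervalIntegrable_const
      fun x hx ↦ hL hx.2
  rw [intervalIntegral.integral_const, smul_eq_mul, add_sub_cancel_left] at e3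
  linarith

/-- If the monotone function `L` grows at most like `log r`, then the set where passing from `r` to
`r + r ^ (3/4)` increases `L` by more than `log 2` has finite logarithmic measure. On the dyadic
interval from `A` to `2 A`, its logarithmic measure is `O (A ^ (-1/8))`. -/
lemma finiteLogMeasure_growth {L : ℝ → ℝ} (hL : Monotone L) (hL0 : ∀ r, 0 ≤ L r) {K r₀ : ℝ}
    (hr₀ : 1 ≤ r₀) (hK : 0 ≤ K) (hLK : ∀ r, r₀ ≤ r → L r ≤ K * log r) :
    FiniteLogMeasure {r | r₀ ≤ r ∧ log 2 < L (enlarge r) - L r} := by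
  have hmeas : Measurable enlarge := by unfold enlarge; fun_prop
  set F := {r | r₀ ≤ r ∧ log 2 < L (enlarge r) - L r} with hF
  have hFm : MeasurableSet F := measurableSet_Ici.inter
    (measurableSet_lt measurable_const ((hL.measurable.comp hmeas).sub hL.measurable))
  have hlog2 : 0 < log 2 := log_pos (by norm_num)
  refine ⟨hFm, fun r hr ↦ lt_of_lt_of_le one_pos (hr₀.trans hr.1), ?_⟩
  set q : ℝ := (2 : ℝ) ^ (-(1 / 8) : ℝ) with hq
  have hq0 : 0 ≤ q := by positivity
  have hq1 : q < 1 := rpow_lt_one_of_one_lt_of_neg (by norm_num) (by norm_num)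
  set C := 64 * K / log 2 with hC
  have hC0 : 0 ≤ C := by positivity
  have hpiece : ∀ k : ℕ, ∫⁻ r in F ∩ Icc (r₀ * 2 ^ k) (2 * (r₀ * 2 ^ k)), ENNReal.ofReal (1 / r) ≤
      ENNReal.ofReal (C * q ^ k) := by
    intro k
    set A := r₀ * 2 ^ k with hA
    have h2k : (1 : ℝ) ≤ 2 ^ k := one_le_pow₀ (by norm_num)
    have hAr : r₀ ≤ A := le_mul_of_one_le_right (by linarith) h2k
    have hA1 : 1 ≤ A := hr₀.trans hAr
    have hA0 : 0 < A := by linarith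
    set h := (2 * A) ^ (3 / 4 : ℝ) with hh
    have hh0 : 0 ≤ h := by positivity
    have hh1 : h ≤ 2 * A := rpow_le_self_of_one_le (by linarith)
    have hh2 : h ≤ 2 * A ^ (3 / 4 : ℝ) := by
      rw [hh, mul_rpow (by norm_num) hA0.le]
      gcongr
      exact rpow_le_self_of_one_le (by norm_num)
    have hLA : L (2 * A + h) ≤ K * (32 * A ^ (1 / 8 : ℝ)) := by
      refine (hLK _ (by linarith)).trans (mul_le_mul_of_nonneg_left ?_ hK)
      calc log (2 * A + h) ≤ log (4 * A) := log_le_log (by linarith) (by linarith)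
        _ ≤ (4 * A) ^ (1 / 8 : ℝ) / (1 / 8) := log_le_rpow_div (by linarith) (by norm_num)
        _ = 8 * (4 ^ (1 / 8 : ℝ) * A ^ (1 / 8 : ℝ)) := by
            rw [mul_rpow (by norm_num) hA0.le]; ring
        _ ≤ 8 * (4 * A ^ (1 / 8 : ℝ)) := by
            gcongr
            exact (rpow_le_rpow_of_exponent_le (by norm_num)
              (show (1 / 8 : ℝ) ≤ 1 by norm_num)).trans_eq (rpow_one _)
        _ = 32 * A ^ (1 / 8 : ℝ) := by ring
    have hvol := log_two_mul_volume_le hL hL0 hA0.le hh0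
    set v := (volume.restrict (Icc A (2 * A))).real {r | log 2 ≤ L (r + h) - L r} with hv
    have hsub : volume (F ∩ Icc A (2 * A)) ≤ ENNReal.ofReal v := by
      rw [hv, measureReal_def, ENNReal.ofReal_toReal (measure_ne_top _ _)]
      rw [Measure.restrict_apply' measurableSet_Icc]
      refine measure_mono fun r hr ↦ ⟨hr.1.2.le.trans (sub_le_sub_right (hL ?_) _), hr.2⟩
      have : r ^ (3 / 4 : ℝ) ≤ h := rpow_le_rpow (hA0.le.trans hr.2.1) hr.2.2 (by norm_num)
      unfold enlarge
      linarith
    have hpow : A ^ (3 / 4 : ℝ) * A ^ (1 / 8 : ℝ) / A = A ^ (-(1 / 8) : ℝ) := by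
      rw [← rpow_add hA0]
      nth_rw 2 [← rpow_one A]
      rw [← rpow_sub hA0]; norm_num
    have hAq : A ^ (-(1 / 8) : ℝ) ≤ q ^ k := by
      rw [hq, ← rpow_natCast, ← rpow_mul (by norm_num), mul_comm, rpow_mul (by norm_num),
        rpow_natCast]
      refine rpow_le_rpow_of_nonpos (by positivity) ?_ (by norm_num)
      rw [hA]; exact le_mul_of_one_le_left (by positivity) hr₀
    calc ∫⁻ r in F ∩ Icc A (2 * A), ENNReal.ofReal (1 / r)
        ≤ ∫⁻ _ in F ∩ Icc A (2 * A), ENNReal.ofReal (1 / A) := by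
          refine setLIntegral_mono' (hFm.inter measurableSet_Icc) fun r hr ↦ ?_
          exact ENNReal.ofReal_le_ofReal (one_div_le_one_div_of_le hA0 hr.2.1)
      _ = ENNReal.ofReal (1 / A) * volume (F ∩ Icc A (2 * A)) := by rw [setLIntegral_const]
      _ ≤ ENNReal.ofReal (1 / A) * ENNReal.ofReal v := by gcongr
      _ = ENNReal.ofReal (1 / A * v) := (ENNReal.ofReal_mul (by positivity)).symm
      _ ≤ ENNReal.ofReal (C * q ^ k) := by
          refine ENNReal.ofReal_le_ofReal ?_
          have hv1 : v ≤ h * L (2 * A + h) / log 2 := by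
            rw [le_div_iff₀ hlog2, mul_comm]; exact hvol
          calc 1 / A * v
              ≤ 1 / A * ((2 * A ^ (3 / 4 : ℝ)) * (K * (32 * A ^ (1 / 8 : ℝ))) / log 2) := by
                gcongr
                refine hv1.trans ?_
                gcongr
                exact hL0 _
            _ = C * (A ^ (3 / 4 : ℝ) * A ^ (1 / 8 : ℝ) / A) := by
                rw [hC]; ring
            _ ≤ C * q ^ k := by rw [hpow]; gcongr
  have hcover : F ⊆ ⋃ k : ℕ, F ∩ Icc (r₀ * 2 ^ k) (2 * (r₀ * 2 ^ k)) := by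
    intro r hr
    obtain ⟨k, hk1, hk2⟩ := exists_nat_pow_near (x := r / r₀) (y := 2)
      (by rw [one_le_div (by linarith)]; exact hr.1) (by norm_num)
    rw [le_div_iff₀ (by linarith)] at hk1
    rw [div_lt_iff₀ (by linarith), pow_succ] at hk2
    exact mem_iUnion.2 ⟨k, hr, by linarith, by linarith⟩
  calc ∫⁻ r in F, ENNReal.ofReal (1 / r)
      ≤ ∫⁻ r in ⋃ k : ℕ, F ∩ Icc (r₀ * 2 ^ k) (2 * (r₀ * 2 ^ k)), ENNReal.ofReal (1 / r) :=
        lintegral_mono_set hcover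
    _ ≤ ∑' k : ℕ, ∫⁻ r in F ∩ Icc (r₀ * 2 ^ k) (2 * (r₀ * 2 ^ k)), ENNReal.ofReal (1 / r) :=
        lintegral_iUnion_le _ _
    _ ≤ ∑' k : ℕ, ENNReal.ofReal (C * q ^ k) := ENNReal.tsum_le_tsum hpiece
    _ < ⊤ := ((summable_geometric_of_lt_one hq0 hq1).mul_left C).tsum_ofReal_lt_top

lemma exists_posLog_T_le {f : ℂ → ℂ} (h : order f < ⊤) :
    ∃ K : ℝ, 0 ≤ K ∧ ∀ᶠ r in atTop, log⁺ (T f r) ≤ K * log r := by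
  obtain ⟨M, hM1, hM2⟩ := EReal.lt_iff_exists_real_btwn.1 h
  refine ⟨max M 0, le_max_right _ _, ?_⟩
  filter_upwards [Filter.eventually_lt_of_limsup_lt hM1, eventually_gt_atTop 1] with r hr hr1
  have hlog : 0 < log r := log_pos hr1
  rw [EReal.coe_lt_coe_iff, div_lt_iff₀ hlog] at hr
  exact hr.le.trans (mul_le_mul_of_nonneg_right (le_max_left _ _) hlog.le)

lemma tendsto_T_atTop {f : ℂ → ℂ} (hf : Meromorphic f)
    (hf_nonconst : ¬ ∃ k : ℂ, MerEq f (fun _ ↦ k)) : Tendsto (T f) atTop atTop := by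
  classical
  -- `f - f z₀` has a zero at a point `z₀` of analyticity, so that its zeros are counted by an
  -- unbounded function
  obtain ⟨z₀, hz₀⟩ : ∃ z₀, AnalyticAt ℂ f z₀ :=
    (hf 0).eventually_analyticAt.exists
  set w := f z₀
  have hfw : Meromorphic (fun z ↦ f z - w) := hf.sub (Meromorphic.const w)
  have hord : ∀ z, meromorphicOrderAt (fun z ↦ f z - w) z ≠ ⊤ := by
    rcases eq_zero_or_meromorphicOrderAt_ne_top hfw with h | h
    · refine absurd ⟨w, ?_⟩ hf_nonconst
      filter_upwards [h] with z hz using sub_eq_zero.1 hz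
    · exact h
  have han : AnalyticAt ℂ (fun z ↦ f z - w) z₀ := hz₀.sub analyticAt_const
  have hpos : 0 < meromorphicOrderAt (fun z ↦ f z - w) z₀ := by
    have h1 := han.meromorphicOrderAt_nonneg
    refine lt_of_le_of_ne h1 fun h0 ↦ ?_
    have := (han.meromorphicNFAt.meromorphicOrderAt_eq_zero_iff).1 h0.symm
    exact this (sub_self _)
  set D := MeromorphicOn.divisor (fun z ↦ f z - w) univ
  have hD : 1 ≤ D z₀ := by
    rw [MeromorphicOn.divisor_apply hfw.meromorphicOn (mem_univ _)]
    obtain ⟨m, hm⟩ := WithTop.ne_top_iff_exists.1 (hord z₀)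
    rw [← hm] at hpos ⊢
    have : 0 < m := by exact_mod_cast hpos
    simpa using Int.add_one_le_iff.2 this
  have hsingle : Function.locallyFinsuppWithin.single z₀ 1 ≤ D⁺ := by
    intro z
    rw [Function.locallyFinsuppWithin.posPart_apply]
    rcases eq_or_ne z z₀ with rfl | hz
    · simpa using hD.trans (le_posPart _)
    · simp [Function.locallyFinsuppWithin.single_apply, hz, posPart_nonneg]
  set C := max |log ‖f 0 - w‖| |log ‖meromorphicTrailingCoeffAt (fun z ↦ f z - w) 0‖|
  have hle : ∀ᶠ r in atTop, Function.locallyFinsuppWithin.logCounting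
      (Function.locallyFinsuppWithin.single z₀ 1) r - (C + (log⁺ ‖w‖ + log 2)) ≤ T f r := by
    filter_upwards [eventually_ge_atTop 1] with r hr
    have h1 := Function.locallyFinsuppWithin.logCounting_le hsingle hr
    have h2 : D⁺.logCounting r = logCounting (fun z ↦ f z - w)⁻¹ ⊤ r := by
      rw [ValueDistribution.logCounting_inv, logCounting_zero]
    have h3 : logCounting (fun z ↦ f z - w)⁻¹ ⊤ r ≤ characteristic (fun z ↦ f z - w)⁻¹ ⊤ r := by
      have := proximity_nonneg (f := (fun z ↦ f z - w)⁻¹) (a := ⊤) r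
      simp only [characteristic, Pi.add_apply, Pi.zero_apply] at this ⊢
      linarith
    have h4 := (abs_le.1 (characteristic_sub_characteristic_inv_le hfw (R := r))).1
    have h5 := (abs_le.1 (abs_characteristic_sub_characteristic_shift_le (a₀ := w) (r := r) hf)).1
    unfold T
    linarith
  refine tendsto_atTop_mono' _ hle (tendsto_atTop_add_const_right _ _ ?_)
  have h6 := Function.locallyFinsuppWithin.one_isLittleO_logCounting_single (e := z₀)
  have h7 := (isLittleO_const_left_of_ne (one_ne_zero (α := ℝ))).1 h6
  refine h7.congr' ?_
  filter_upwards [eventually_ge_atTop 1] with r hr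
  refine Real.norm_of_nonneg (Function.locallyFinsuppWithin.logCounting_nonneg ?_ hr)
  intro z
  rcases eq_or_ne z z₀ with rfl | hz
  · simp
  · simp [Function.locallyFinsuppWithin.single_apply, hz]

lemma exists_T_enlarge_isBigO {f : ℂ → ℂ} (hf : Meromorphic f)
    (hf_nonconst : ¬ ∃ k : ℂ, MerEq f (fun _ ↦ k)) (hf_order : order f < ⊤) :
    ∃ F, FiniteLogMeasure F ∧ (fun r ↦ T f (enlarge r)) =O[atTopOff F] T f := by
  obtain ⟨K, hK, hev⟩ := exists_posLog_T_le hf_order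
  obtain ⟨r₀, hr₀⟩ := eventually_atTop.1 hev
  have hmono : Monotone fun r ↦ log⁺ (T f (max r 1)) := by
    intro x y hxy
    refine posLog_le_posLog (T_nonneg f (le_max_right _ _)) ?_
    exact characteristic_monotoneOn hf (lt_of_lt_of_le one_pos (le_max_right x 1))
      (lt_of_lt_of_le one_pos (le_max_right y 1)) (max_le_max_right 1 hxy)
  have hF := finiteLogMeasure_growth hmono (fun _ ↦ posLog_nonneg) (le_max_right r₀ 1) hK
    (fun r hr ↦ by
      rw [max_eq_left ((le_max_right r₀ 1).trans hr)]
      exact hr₀ r ((le_max_left _ _).trans hr))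
  refine ⟨_, hF, ?_⟩
  set F := {r | max r₀ 1 ≤ r ∧ log 2 < log⁺ (T f (max (enlarge r) 1)) - log⁺ (T f (max r 1))}
  have h1 : ∀ᶠ r in atTopOff F, max r₀ 1 ≤ r ∧ 1 ≤ T f r :=
    ((eventually_ge_atTop _).and
      ((tendsto_T_atTop hf hf_nonconst).eventually_ge_atTop 1)).filter_mono (atTopOff_le F)
  have h2 : ∀ᶠ r in atTopOff F, r ∈ Fᶜ := Filter.Eventually.filter_mono inf_le_right
    (mem_principal_self _)
  refine IsBigO.of_bound 2 ?_
  filter_upwards [h1, h2] with r hr hrF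
  have hr1 : 1 ≤ r := (le_max_right _ _).trans hr.1
  have her : 1 ≤ enlarge r := hr1.trans (self_le_enlarge (by linarith))
  have h3 : log⁺ (T f (max (enlarge r) 1)) - log⁺ (T f (max r 1)) ≤ log 2 :=
    not_lt.1 fun h ↦ hrF ⟨hr.1, h⟩
  rw [max_eq_left her, max_eq_left hr1] at h3
  rw [Real.norm_of_nonneg (T_nonneg f her), Real.norm_of_nonneg (by linarith)]
  rw [posLog_eq_log (x := T f r) (by rw [abs_of_nonneg (by linarith)]; exact hr.2)] at h3
  have h4 : log (T f (enlarge r)) ≤ log (2 * T f r) := by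
    rw [log_mul (by norm_num) (by linarith)]
    have : log (T f (enlarge r)) ≤ log⁺ (T f (enlarge r)) := le_max_right _ _
    linarith
  rcases (T_nonneg f her).eq_or_lt with h0 | h0
  · rw [← h0]; linarith
  · exact (log_le_log_iff h0 (by linarith)).1 h4

/-! ### Algebra of small functions -/

lemma T_const (k : ℂ) (r : ℝ) : T (fun _ ↦ k) r = log⁺ ‖k‖ := by
  have h : logCounting (fun _ : ℂ ↦ k) ⊤ = 0 := logCounting_const
  simp [T, characteristic, proximity_top, h, circleAverage_const]

/-- The product inequality `T (r, fg) ≤ T (r, f) + T (r, g)`, including the case where one of the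
factors vanishes identically. -/
lemma T_mul_le {f g : ℂ → ℂ} (hf : Meromorphic f) (hg : Meromorphic g) {r : ℝ} (hr : 1 ≤ r) :
    T (f * g) r ≤ T f r + T g r := by
  have h0 : ∀ {h : ℂ → ℂ}, h =ᶠ[codiscrete ℂ] 0 → T h r = 0 := fun hh ↦ by
    rw [T_congr hh (by linarith), T_zero]
  have hT := add_nonneg (T_nonneg f hr) (T_nonneg g hr)
  rcases eq_zero_or_meromorphicOrderAt_ne_top hf with hf0 | hf0
  · rw [h0 (h := f * g) (by filter_upwards [hf0] with z hz; simp [hz])]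
    exact hT
  rcases eq_zero_or_meromorphicOrderAt_ne_top hg with hg0 | hg0
  · rw [h0 (h := f * g) (by filter_upwards [hg0] with z hz; simp [hz])]
    exact hT
  exact characteristic_mul_top_le hr hf hf0 hg hg0

lemma T_add_le {f g : ℂ → ℂ} (hf : Meromorphic f) (hg : Meromorphic g) {r : ℝ} (hr : 1 ≤ r) :
    T (f + g) r ≤ T f r + T g r + log 2 := characteristic_add_top_le hf hg hr

lemma T_sub_le {f g : ℂ → ℂ} (hf : Meromorphic f) (hg : Meromorphic g) {r : ℝ} (hr : 1 ≤ r) :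
    T (f - g) r ≤ T f r + T g r + log 2 := by
  have hc : Meromorphic fun _ : ℂ ↦ (-1 : ℂ) := Meromorphic.const _
  have h1 := T_add_le hf (hc.mul hg) hr
  have h2 := T_mul_le hc hg hr
  have h3 : f - g = f + (fun _ ↦ (-1 : ℂ)) * g := by ext z; simp [sub_eq_add_neg]
  rw [T_const] at h2
  simp only [norm_neg, norm_one, posLog_one, zero_add] at h2
  rw [h3]
  linarith

/-- `b` is meromorphic, and `T (r, b) = o (S r)` along the filter `l`. -/
def SmallAlong (l : Filter ℝ) (S : ℝ → ℝ) (b : ℂ → ℂ) : Prop :=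
  Meromorphic b ∧ T b =o[l] S

namespace SmallAlong

variable {l : Filter ℝ} {S : ℝ → ℝ} {a b : ℂ → ℂ}

lemma const (h1 : (fun _ ↦ (1 : ℝ)) =o[l] S) (k : ℂ) : SmallAlong l S fun _ ↦ k := by
  refine ⟨Meromorphic.const k, ?_⟩
  have : T (fun _ ↦ k) = fun _ ↦ log⁺ ‖k‖ * 1 := by ext r; rw [T_const, mul_one]
  rw [this]
  exact h1.const_mul_left _

lemma add (hl : l ≤ atTop) (h1 : (fun _ ↦ (1 : ℝ)) =o[l] S) (ha : SmallAlong l S a)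
    (hb : SmallAlong l S b) : SmallAlong l S (a + b) := by
  refine ⟨ha.1.add hb.1, IsBigO.trans_isLittleO (IsBigO.of_bound 1 ?_)
    ((ha.2.add hb.2).add (h1.const_mul_left (log 2)))⟩
  filter_upwards [(eventually_ge_atTop 1).filter_mono hl] with r hr
  have := T_add_le ha.1 hb.1 hr
  rw [Real.norm_of_nonneg (T_nonneg _ hr), one_mul]
  exact le_trans (by simpa using this) (le_abs_self _)

lemma mul (hl : l ≤ atTop) (ha : SmallAlong l S a) (hb : SmallAlong l S b) :
    SmallAlong l S (a * b) := by
  refine ⟨ha.1.mul hb.1, IsBigO.trans_isLittleO (IsBigO.of_bound 1 ?_) (ha.2.add hb.2)⟩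
  filter_upwards [(eventually_ge_atTop 1).filter_mono hl] with r hr
  rw [Real.norm_of_nonneg (T_nonneg _ hr), one_mul]
  exact (T_mul_le ha.1 hb.1 hr).trans (le_abs_self _)

lemma pow (hl : l ≤ atTop) (h1 : (fun _ ↦ (1 : ℝ)) =o[l] S) (ha : SmallAlong l S a) (n : ℕ) :
    SmallAlong l S (a ^ n) := by
  induction n with
  | zero => exact const h1 1
  | succ n ih => rw [pow_succ]; exact ih.mul hl ha

lemma prod (hl : l ≤ atTop) (h1 : (fun _ ↦ (1 : ℝ)) =o[l] S) {ι : Type*} (s : Finset ι)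
    {a : ι → ℂ → ℂ} (ha : ∀ i ∈ s, SmallAlong l S (a i)) : SmallAlong l S (∏ i ∈ s, a i) :=
  Finset.prod_induction _ (SmallAlong l S) (fun _ _ ↦ mul hl) (const h1 1) ha

lemma sum (hl : l ≤ atTop) (h1 : (fun _ ↦ (1 : ℝ)) =o[l] S) {ι : Type*} (s : Finset ι)
    {a : ι → ℂ → ℂ} (ha : ∀ i ∈ s, SmallAlong l S (a i)) : SmallAlong l S (∑ i ∈ s, a i) :=
  Finset.sum_induction _ (SmallAlong l S) (fun _ _ ↦ add hl h1) (const h1 0) ha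

lemma evalAt (hl : l ≤ atTop) (h1 : (fun _ ↦ (1 : ℝ)) =o[l] S) {n : ℕ} {c : Fin n → ℂ}
    {P : MvPolynomial (Fin n) (ℂ → ℂ)} (hP : ∀ i ∈ P.support, SmallAlong l S (P.coeff i))
    (ha : ∀ j, SmallAlong l S fun z ↦ a (z + c j)) :
    SmallAlong l S (DifferenceNevanlinna.evalAt c P a) := by
  rw [DifferenceNevanlinna.evalAt, MvPolynomial.eval_eq']
  exact sum hl h1 _ fun i hi ↦ (hP i hi).mul hl (prod hl h1 _ fun j _ ↦ (ha j).pow hl h1 _)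

/-- By the first main theorem, `T (r, 1 / b)` is small if `T (r, b)` is. -/
lemma inv (hl : l ≤ atTop) (h1 : (fun _ ↦ (1 : ℝ)) =o[l] S) (hb : SmallAlong l S b) :
    SmallAlong l S b⁻¹ := by
  refine ⟨hb.1.inv, ?_⟩
  have h3 := ((isBigO_characteristic_sub_characteristic_inv hb.1).mono hl).trans_isLittleO h1
  have h4 : T b⁻¹ = fun r ↦ T b r - (characteristic b ⊤ - characteristic b⁻¹ ⊤) r := by
    ext r; simp [T]
  rw [h4]
  exact hb.2.sub h3

end SmallAlong

/-- `u` is integrable over circles about the origin, and its mean over the circle of radius `r` is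
`o (S r)` along the filter `l`. -/
def SmallMean (l : Filter ℝ) (S : ℝ → ℝ) (u : ℂ → ℝ) : Prop :=
  (∀ r, CircleIntegrable u 0 r) ∧ (fun r ↦ circleAverage u 0 r) =o[l] S

namespace SmallMean

variable {l : Filter ℝ} {S : ℝ → ℝ} {u v : ℂ → ℝ}

lemma const (h1 : (fun _ ↦ (1 : ℝ)) =o[l] S) (k : ℝ) : SmallMean l S fun _ ↦ k := by
  refine ⟨fun r ↦ circleIntegrable_const _ _ _, ?_⟩
  simp_rw [circleAverage_const]
  simpa using h1.const_mul_left k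

lemma add (hu : SmallMean l S u) (hv : SmallMean l S v) : SmallMean l S fun z ↦ u z + v z := by
  refine ⟨fun r ↦ (hu.1 r).add (hv.1 r), (hu.2.add hv.2).congr_left fun r ↦ ?_⟩
  exact (circleAverage_fun_add (hu.1 r) (hv.1 r)).symm

lemma const_mul (k : ℝ) (hu : SmallMean l S u) : SmallMean l S fun z ↦ k * u z := by
  refine ⟨fun r ↦ (hu.1 r).const_smul (a := k), (hu.2.const_mul_left k).congr_left fun r ↦ ?_⟩
  exact (circleAverage_const_mul k u r).symm

lemma sum {ι : Type*} (s : Finset ι) {u : ι → ℂ → ℝ} (hu : ∀ i ∈ s, SmallMean l S (u i)) :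
    SmallMean l S fun z ↦ ∑ i ∈ s, u i z := by
  refine ⟨fun r ↦ ?_, ?_⟩
  · simpa [Finset.sum_fn] using CircleIntegrable.sum s fun i hi ↦ (hu i hi).1 r
  · simp_rw [circleAverage_fun_sum fun i hi ↦ (hu i hi).1 _]
    exact IsLittleO.fun_sum fun i hi ↦ (hu i hi).2

end SmallMean

lemma smallMean_posLog {l : Filter ℝ} {S : ℝ → ℝ} {b : ℂ → ℂ} (hb : Meromorphic b)
    (h : (fun r ↦ proximity b ⊤ r) =o[l] S) : SmallMean l S fun z ↦ log⁺ ‖b z‖ := by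
  refine ⟨fun r ↦ MeromorphicOn.circleIntegrable_posLog_norm hb.meromorphicOn, ?_⟩
  simpa [proximity_top] using h

lemma SmallAlong.smallMean {l : Filter ℝ} {S : ℝ → ℝ} {b : ℂ → ℂ} (hl : l ≤ atTop)
    (hb : SmallAlong l S b) : SmallMean l S fun z ↦ log⁺ ‖b z‖ := by
  refine smallMean_posLog hb.1 (IsBigO.trans_isLittleO (IsBigO.of_bound 1 ?_) hb.2)
  filter_upwards [(eventually_ge_atTop 1).filter_mono hl] with r hr
  have h1 := proximity_nonneg (f := b) (a := ⊤) r
  have h2 : 0 ≤ logCounting b ⊤ r := logCounting_nonneg hr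
  rw [Real.norm_of_nonneg h1, Real.norm_of_nonneg (T_nonneg b hr)]
  simp only [T, characteristic, Pi.add_apply]
  linarith

/-! ### Taylor-type estimates for polynomials -/

/-- The condition `t ‖u‖ + ‖u' - u‖ ≤ t B`, which says that `u'` is close to `u` at scale `t`,
is stable under multiplication. -/
lemma scaled_norm_mul_le {u u' v v' : ℂ} {t B B' : ℝ} (ht0 : 0 < t) (ht1 : t ≤ 1)
    (hu : t * ‖u‖ + ‖u' - u‖ ≤ t * B) (hv : t * ‖v‖ + ‖v' - v‖ ≤ t * B') :
    t * ‖u * v‖ + ‖u' * v' - u * v‖ ≤ t * (B * B') := by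
  have e : u' * v' - u * v = u * (v' - v) + (u' - u) * v + (u' - u) * (v' - v) := by ring
  have h1 : ‖u' * v' - u * v‖ ≤
      ‖u‖ * ‖v' - v‖ + ‖u' - u‖ * ‖v‖ + ‖u' - u‖ * ‖v' - v‖ := by
    rw [e]
    refine (norm_add₃_le).trans_eq ?_
    simp only [norm_mul]
  set α := ‖u‖
  set β := ‖v‖
  set ε := ‖u' - u‖
  set η := ‖v' - v‖
  have hα : 0 ≤ α := norm_nonneg _
  have hβ : 0 ≤ β := norm_nonneg _
  have hε : 0 ≤ ε := norm_nonneg _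
  have hη : 0 ≤ η := norm_nonneg _
  have hε' : ε ≤ t * (B - α) := by linarith
  have hη' : η ≤ t * (B' - β) := by linarith
  have hB : 0 ≤ B - α := by
    by_contra h
    nlinarith
  have hB' : 0 ≤ B' - β := by
    by_contra h
    nlinarith
  have h2 : α * η ≤ α * (t * (B' - β)) := by gcongr
  have h3 : ε * β ≤ t * (B - α) * β := by gcongr
  have h4 : ε * η ≤ t * (B - α) * (t * (B' - β)) := by gcongr
  have h5 : t * (B - α) * (t * (B' - β)) ≤ t * ((B - α) * (B' - β)) := by
    have : t * (t * ((B - α) * (B' - β))) ≤ 1 * (t * ((B - α) * (B' - β))) := by gcongr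
    linarith
  rw [norm_mul]
  linarith

lemma scaled_norm_prod_le {ι : Type*} (s : Finset ι) (k : ι → ℕ) {u u' : ι → ℂ} {t : ℝ}
    {B : ι → ℝ} (ht0 : 0 < t) (ht1 : t ≤ 1)
    (hu : ∀ i ∈ s, t * ‖u i‖ + ‖u' i - u i‖ ≤ t * B i) :
    t * ‖∏ i ∈ s, u i ^ k i‖ + ‖∏ i ∈ s, u' i ^ k i - ∏ i ∈ s, u i ^ k i‖ ≤
      t * ∏ i ∈ s, B i ^ k i := by
  classical
  have hpow : ∀ i ∈ s, ∀ m : ℕ, t * ‖u i ^ m‖ + ‖u' i ^ m - u i ^ m‖ ≤ t * B i ^ m := by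
    intro i hi m
    induction m with
    | zero => simp
    | succ m ih => simp only [pow_succ]; exact scaled_norm_mul_le ht0 ht1 ih (hu i hi)
  induction s using Finset.induction with
  | empty => simp
  | insert i s his ih =>
    simp only [Finset.prod_insert his]
    exact scaled_norm_mul_le ht0 ht1 (hpow i (Finset.mem_insert_self _ _) _)
      (ih (fun j hj ↦ hu j (Finset.mem_insert_of_mem hj))
        fun j hj ↦ hpow j (Finset.mem_insert_of_mem hj))

/-- At a point where `P (z, f) = 0`, `P (z, a) ≠ 0` and `f z ≠ a z`, expanding `P (z, f)` about `a`
bounds `1 / |f - a|` by the coefficients of `P`, by `1 / P (z, a)`, by the shifts of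
`a` and by the difference quotients of `f - a`. -/
lemma posLog_inv_sub_le {n : ℕ} (c : Fin n → ℂ) (P : MvPolynomial (Fin n) (ℂ → ℂ)) (f a : ℂ → ℂ)
    {z : ℂ} (hf : evalAt c P f z = 0) (ha : evalAt c P a z ≠ 0) (hfa : f z - a z ≠ 0) :
    log⁺ ‖1 / (f z - a z)‖ ≤ log⁺ ‖(evalAt c P a)⁻¹ z‖ + (log (P.support.card : ℝ) +
      ∑ l ∈ P.support, (log⁺ ‖P.coeff l z‖ + ∑ j, (l j : ℝ) * (log 2 + (log⁺ ‖a (z + c j)‖ +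
        log⁺ ‖(f (z + c j) - a (z + c j)) / (f z - a z)‖)))) := by
  set q : Fin n → ℝ := fun j ↦ ‖(f (z + c j) - a (z + c j)) / (f z - a z)‖ with hq
  have hq0 : ∀ j, 0 ≤ q j := fun j ↦ norm_nonneg _
  set M := ∑ l ∈ P.support, ‖P.coeff l z‖ * ∏ j, (‖a (z + c j)‖ + q j) ^ l j with hM
  have hM0 : 0 ≤ M := Finset.sum_nonneg fun l _ ↦ mul_nonneg (norm_nonneg _)
    (Finset.prod_nonneg fun j _ ↦ pow_nonneg (add_nonneg (norm_nonneg _) (hq0 j)) _)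
  have hlogM : log⁺ M ≤ log (P.support.card : ℝ) + ∑ l ∈ P.support, (log⁺ ‖P.coeff l z‖ +
      ∑ j, (l j : ℝ) * (log 2 + (log⁺ ‖a (z + c j)‖ + log⁺ (q j)))) := by
    refine (posLog_sum _ _).trans (add_le_add_right (Finset.sum_le_sum fun l _ ↦ ?_) _)
    refine posLog_mul.trans (add_le_add_right ((posLog_prod _ _).trans
      (Finset.sum_le_sum fun j _ ↦ ?_)) _)
    rw [posLog_pow]
    refine mul_le_mul_of_nonneg_left ?_ (Nat.cast_nonneg _)
    have := posLog_add (x := ‖a (z + c j)‖) (y := q j)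
    linarith
  refine le_trans ?_ (add_le_add_right hlogM _)
  set t := ‖f z - a z‖ with ht
  have ht0 : 0 < t := norm_pos_iff.2 hfa
  rcases le_or_gt t 1 with ht1 | ht1
  · have hD : ‖evalAt c P a z‖ ≤ t * M := by
      have e : evalAt c P a z = -∑ l ∈ P.support, P.coeff l z *
          (∏ j, f (z + c j) ^ l j - ∏ j, a (z + c j) ^ l j) := by
        simp only [mul_sub, Finset.sum_sub_distrib]
        rw [← evalAt_apply, ← evalAt_apply, hf]; ring
      rw [e, norm_neg, hM, Finset.mul_sum]
      refine norm_sum_le_of_le _ fun l _ ↦ ?_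
      rw [norm_mul, mul_left_comm]
      refine mul_le_mul_of_nonneg_left ?_ (norm_nonneg _)
      have h1 := scaled_norm_prod_le Finset.univ (fun j ↦ l j) (u := fun j ↦ a (z + c j))
        (u' := fun j ↦ f (z + c j)) (B := fun j ↦ ‖a (z + c j)‖ + q j) ht0 ht1 (by
          intro j _
          have : ‖f (z + c j) - a (z + c j)‖ = t * q j := by
            simp only [hq]; rw [norm_div, ← ht]; field_simp
          rw [this, mul_add])
      have h2 : 0 ≤ t * ‖∏ j, a (z + c j) ^ l j‖ := by positivity
      linarith
    have h1 : ‖1 / (f z - a z)‖ ≤ ‖(evalAt c P a)⁻¹ z‖ * M := by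
      have hDp : 0 < ‖evalAt c P a z‖ := norm_pos_iff.2 ha
      rw [norm_div, norm_one, ← ht, Pi.inv_apply, norm_inv, div_le_iff₀ ht0, inv_mul_eq_div,
        div_mul_eq_mul_div, le_div_iff₀ hDp, one_mul, mul_comm M t]
      exact hD
    exact (posLog_le_posLog (norm_nonneg _) h1).trans posLog_mul
  · have h0 : log⁺ ‖1 / (f z - a z)‖ = 0 := by
      rw [posLog_eq_zero_iff, abs_norm, norm_div, norm_one]
      exact div_le_one_of_le₀ ht1.le ht0.le
    rw [h0]
    exact add_nonneg posLog_nonneg posLog_nonneg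

/-! ### Targets that do not solve the equation -/

lemma evalAt_congr {n : ℕ} (c : Fin n → ℂ) (P : MvPolynomial (Fin n) (ℂ → ℂ)) {f a : ℂ → ℂ}
    (h : f =ᶠ[codiscrete ℂ] a) : evalAt c P f =ᶠ[codiscrete ℂ] evalAt c P a := by
  have h1 : ∀ᶠ z in codiscrete ℂ, ∀ j, f (z + c j) = a (z + c j) :=
    Filter.eventually_all.2 fun j ↦ (tendsto_add_const_codiscrete (c j)).eventually h
  filter_upwards [h1] with z hz
  simp only [evalAt_apply, hz]

/-- The estimate `m (r, 1 / (f - a)) = o (T (r, f))`, off a set of finite logarithmic measure. -/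
theorem exists_m_inv_sub_isLittleO {n : ℕ} (c : Fin n → ℂ) (P : MvPolynomial (Fin n) (ℂ → ℂ))
    (f a : ℂ → ℂ) (hf : Meromorphic f) (hf_nonconst : ¬ ∃ k : ℂ, MerEq f (fun _ ↦ k))
    (hf_order : order f < ⊤) (hP : IsDifferencePolynomial f P) (hPf : MerEq (evalAt c P f) 0)
    (ha : IsSmall f a) (hPa : ¬ MerEq (evalAt c P a) 0) :
    ∃ E, FiniteLogMeasure E ∧ m (fun z ↦ 1 / (f z - a z)) =o[atTopOff E] T f := by
  obtain ⟨ham, Ea, hEa, hTa⟩ := ha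
  choose hcm Ec hEc hTc using hP
  obtain ⟨F, hF, hTF⟩ := exists_T_enlarge_isBigO hf hf_nonconst hf_order
  set E₀ := (⋃ i ∈ P.support, Ec i) ∪ Ea with hE₀
  have hE₀f : FiniteLogMeasure E₀ := (FiniteLogMeasure.biUnion _ fun i _ ↦ hEc i).union hEa
  set G := {r | 1 ≤ r ∧ enlarge r ∈ E₀} with hG
  refine ⟨E₀ ∪ G ∪ F, (hE₀f.union hE₀f.preimage_enlarge).union hF, ?_⟩
  set l := atTopOff (E₀ ∪ G ∪ F) with hl_def
  have hl : l ≤ atTop := atTopOff_le _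
  have hlE₀ : l ≤ atTopOff E₀ := atTopOff_anti (subset_union_left.trans subset_union_left)
  have hlF : l ≤ atTopOff F := atTopOff_anti subset_union_right
  have hle : Tendsto enlarge l (atTopOff E₀) :=
    tendsto_enlarge_atTopOff (subset_union_right.trans subset_union_left)
  have h1 : (fun _ ↦ (1 : ℝ)) =o[l] T f := by
    rw [isLittleO_const_left_of_ne one_ne_zero]
    exact tendsto_norm_atTop_atTop.comp ((tendsto_T_atTop hf hf_nonconst).mono_left hl)
  have hTfe : (fun r ↦ T f (enlarge r)) =O[l] T f := hTF.mono hlF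
  have hTa₀ : T a =o[atTopOff E₀] T f := hTa.mono (atTopOff_anti subset_union_right)
  have hTae : (fun r ↦ T a (enlarge r)) =o[l] T f := (hTa₀.comp_tendsto hle).trans_isBigO hTfe
  have hcoeff : ∀ i ∈ P.support, SmallAlong l (T f) (P.coeff i) := fun i hi ↦
    ⟨hcm i, (hTc i).mono (hlE₀.trans
      (atTopOff_anti ((subset_biUnion_of_mem (u := Ec) hi).trans subset_union_left)))⟩
  have hshift : ∀ j, SmallAlong l (T f) fun z ↦ a (z + c j) := fun j ↦
    ⟨meromorphic_shift ham _, ((T_shift_isBigO ham (c j)).mono hl).trans_isLittleO (hTae.add h1)⟩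
  have hD : SmallAlong l (T f) (evalAt c P a) := SmallAlong.evalAt hl h1 hcoeff hshift
  have hD0 : ∀ z, meromorphicOrderAt (evalAt c P a) z ≠ ⊤ :=
    (eq_zero_or_meromorphicOrderAt_ne_top hD.1).resolve_left hPa
  have hg : Meromorphic (f - a) := hf.sub ham
  have hg0 : ∀ z, meromorphicOrderAt (f - a) z ≠ ⊤ := by
    refine (eq_zero_or_meromorphicOrderAt_ne_top hg).resolve_left fun h ↦ hPa ?_
    have hfa : f =ᶠ[codiscrete ℂ] a := by
      filter_upwards [h] with z hz using sub_eq_zero.1 hz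
    exact (evalAt_congr c P hfa).symm.trans hPf
  have hTge : (fun r ↦ T (f - a) (enlarge r) + 1) =O[l] T f := by
    refine IsBigO.add (IsBigO.trans (IsBigO.of_bound 1 ?_)
      ((hTfe.add hTae.isBigO).add (h1.const_mul_left (log 2)).isBigO)) h1.isBigO
    filter_upwards [(eventually_ge_atTop 1).filter_mono hl] with r hr
    have her : 1 ≤ enlarge r := hr.trans (self_le_enlarge (by linarith))
    rw [Real.norm_of_nonneg (T_nonneg _ her), one_mul]
    exact le_trans (by simpa using T_sub_le hf ham her) (le_abs_self _)
  have hquot : ∀ j, SmallMean l (T f)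
      fun z ↦ log⁺ ‖(f (z + c j) - a (z + c j)) / (f z - a z)‖ := fun j ↦
    smallMean_posLog ((meromorphic_shift hg (c j)).div hg)
      (((proximity_shift_div_isLittleO hg hg0 (c j)).mono hl).trans_isBigO hTge)
  have hU : SmallMean l (T f) fun z ↦ log⁺ ‖(evalAt c P a)⁻¹ z‖ + (log (P.support.card : ℝ) +
      ∑ i ∈ P.support, (log⁺ ‖P.coeff i z‖ + ∑ j, (i j : ℝ) * (log 2 + (log⁺ ‖a (z + c j)‖ +
        log⁺ ‖(f (z + c j) - a (z + c j)) / (f z - a z)‖)))) :=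
    ((hD.inv hl h1).smallMean hl).add ((SmallMean.const h1 _).add (SmallMean.sum _ fun i hi ↦
      ((hcoeff i hi).smallMean hl).add (SmallMean.sum _ fun j _ ↦
        ((SmallMean.const h1 _).add (((hshift j).smallMean hl).add (hquot j))).const_mul _)))
  refine IsBigO.trans_isLittleO (IsBigO.of_bound 1 ?_) hU.2
  filter_upwards [(eventually_ge_atTop 1).filter_mono hl] with r hr
  have hinv : Meromorphic fun z ↦ 1 / (f z - a z) := (Meromorphic.const 1).div hg
  have hm0 : 0 ≤ m (fun z ↦ 1 / (f z - a z)) r := proximity_nonneg r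
  rw [Real.norm_of_nonneg hm0, one_mul]
  refine le_trans ?_ (le_abs_self _)
  rw [m, proximity_top]
  refine circleAverage_mono_of_codiscrete (by linarith)
    (MeromorphicOn.circleIntegrable_posLog_norm hinv.meromorphicOn) (hU.1 r) ?_
  filter_upwards [hPf, eventually_ne_zero hD.1 hD0, eventually_ne_zero hg hg0] with z hz1 hz2 hz3
  exact posLog_inv_sub_le c P f a hz1 hz2 hz3

lemma deficiency_eq_zero {f a : ℂ → ℂ} {E : Set ℝ} (hE : FiniteLogMeasure E)
    (h : m (fun z ↦ 1 / (f z - a z)) =o[atTopOff E] T f) : deficiency a f = 0 := by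
  have := hE.atTopOff_neBot
  refine le_antisymm ?_ ?_
  · have h1 : Tendsto (fun r : ℝ ↦ ((m (fun z ↦ 1 / (f z - a z)) r / T f r : ℝ) : EReal))
        (atTopOff E) (𝓝 ((0 : ℝ) : EReal)) :=
      (continuous_coe_real_ereal.tendsto 0).comp h.tendsto_div_nhds_zero
    exact (liminf_le_liminf_of_le (atTopOff_le E)).trans_eq h1.liminf_eq
  · refine le_liminf_of_le (by isBoundedDefault) ?_
    filter_upwards [eventually_ge_atTop 1] with r hr
    have hm0 : 0 ≤ m (fun z ↦ 1 / (f z - a z)) r := proximity_nonneg r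
    exact_mod_cast div_nonneg hm0 (T_nonneg f hr)

end DifferenceNevanlinna

theorem mainTheorem6 {n : ℕ} (c : Fin n → ℂ) (P : MvPolynomial (Fin n) (ℂ → ℂ)) (f a : ℂ → ℂ)
    (hf : Meromorphic f)
    (hf_nonconst : ¬ ∃ k : ℂ, DifferenceNevanlinna.MerEq f (fun _ ↦ k))
    (hf_order : DifferenceNevanlinna.order f < ⊤)
    (hP : DifferenceNevanlinna.IsDifferencePolynomial f P)
    (hPf : DifferenceNevanlinna.MerEq (DifferenceNevanlinna.evalAt c P f) 0)
    (ha : DifferenceNevanlinna.IsSmall f a)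
    (hPa : ¬ DifferenceNevanlinna.MerEq (DifferenceNevanlinna.evalAt c P a) 0) :
    (∀ δ : ℝ, δ < 1 →
      ∃ E : Set ℝ, DifferenceNevanlinna.FiniteLogMeasure E ∧
        ∃ u v : ℝ → ℝ,
          u =o[DifferenceNevanlinna.atTopOff E] (fun r : ℝ ↦
            DifferenceNevanlinna.T f (r + DifferenceNevanlinna.maxShift c) / r ^ δ) ∧
          v =o[DifferenceNevanlinna.atTopOff E] DifferenceNevanlinna.T f ∧
          ∀ r : ℝ, 0 < r → r ∉ E →
            DifferenceNevanlinna.m (fun z ↦ 1 / (f z - a z)) r = u r + v r) ∧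
    DifferenceNevanlinna.deficiency a f = 0 := by
  obtain ⟨E, hE, hm⟩ := DifferenceNevanlinna.exists_m_inv_sub_isLittleO c P f a hf hf_nonconst
    hf_order hP hPf ha hPa
  -- a single error term `o (T (r, f))` suffices, whatever the value of `δ`
  exact ⟨fun δ _ ↦ ⟨E, hE, 0, _, isLittleO_zero _ _, hm, fun r _ _ ↦ (zero_add _).symm⟩,
    DifferenceNevanlinna.deficiency_eq_zero hE hm⟩
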